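/- Let $\mathcal A$ be a net $O\mapsto\mathcal A(O)$ of type III factors on a Hilbert space, indexed by the bounded open intervals of $\mathbb R$ (chiral case) or by the double cones of two-dimensional Minkowski space, which is isotonous, local and Haag dual ($\mathcal A(O)=\mathcal A(O')'$); write $\mathcal A$ also for the C*-algebra generated by all $\mathcal A(O)$. A *DHR endomorphism* is a unital $*$-endomorphism $\rho$ of $\mathcal A$ that is localized in some region $O$ (i.e. trivial on $\mathcal A(O')$) and such that for every region $\widehat O$ some $\mathrm{Ad}_u\rho$, $u\in\mathcal A$ unitary, is localized in $\widehat O$. Let $\mathrm{Hom}(\rho,\sigma)=\{t\in\mathcal A: t\rho(a)=\sigma(a)t\ \forall a\in\mathcal A\}$; $\rho$ is irreducible if $\mathrm{Hom}(\rho,\rho)=\mathbb C 1$, and $\rho\prec\theta$ means that $\mathrm{Hom}(\rho,\theta)$ contains an isometry. The braiding is $\varepsilon_{\rho,\sigma}=\varepsilon^+_{\rho,\sigma}=\sigma(u_\rho^*)u_\sigma^*u_\rho\rho(u_\sigma)$ with unitaries such that $\mathrm{Ad}_{u_\sigma}\sigma$ is localized in the past (resp. the spacelike left) of $\mathrm{Ad}_{u_\rho}\rho$,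 and $\varepsilon^-_{\rho,\sigma}=\varepsilon_{\sigma,\rho}^*$. The dimension $\dim\rho$ is the infimum of the numbers $d$ for which there are a DHR endomorphism $\overline\rho$, $w\in\mathrm{Hom}(\mathrm{id},\overline\rho\rho)$ and $v\in\mathrm{Hom}(\mathrm{id},\rho\overline\rho)$ with $v^*\rho(w)=w^*\overline\rho(v)=1$ and $w^*w=v^*v=d\cdot 1$ (infinite if there are none). A *Q-system* is a triple $A=(\theta,w,x)$ with $\theta$ a DHR endomorphism of finite dimension, $w\in\mathrm{Hom}(\mathrm{id},\theta)$, $x\in\mathrm{Hom}(\theta,\theta^2)$, and $$w^*x=\theta(w^*)x=1,\quad xx=\theta(x)x,\quad xx^*=\theta(x^*)x,\quad w^*w=x^*x=\sqrt{\dim\theta}\cdot 1 .$$ It defines the extension $\mathcal B=\iota(\mathcal A)v\supset\iota(\mathcal A)$, the $*$-algebra generated by $\mathcal A$ and $v$ with $v^*=\iota(w^*x^*)v$, $v^2=\iota(x)v$, $\iota(w^*)v=1$, $v\iota(a)=\iota(\theta(a))v$, in which every element has a unique expression $\iota(a)v$. Its local algebras are $\mathcal B(O)=\iota(\mathcal A(O))\iota(u)v$,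 where $u\in\mathcal A$ is unitary and $\mathrm{Ad}_u\theta$ is localized in $O$; $\mathcal B$ is *local* if $\mathcal B(O_1)$ and $\mathcal B(O_2)$ commute whenever $O_1$ and $O_2$ are causally separated (disjoint in the chiral case, spacelike separated in the Minkowski case). $A$ is *commutative* if $\varepsilon_{\theta,\theta}x=x$. Let $A_i=(\theta_i,w_i,x_i)$, $i=1,2$, be Q-systems with extensions $\mathcal B_i$, and let $\mathcal C^\pm=\mathcal B_1\times^\pm\mathcal B_2=\iota(\mathcal A)v$ be the extension defined by the braided product $$A_1\times^\pm A_2=\bigl(\theta_1\theta_2,\ \theta_1(w_2)w_1,\ \theta_1(\varepsilon^\pm_{\theta_1,\theta_2})\,x_1\,\theta_1(x_2)\bigr).$$ It contains $\mathcal B_1$ and $\mathcal B_2$ through $v_1=\iota(\theta_1(w_2^*))v$ and $v_2=\iota(w_1^*)v$. The charged fields of $\mathcal B_i$ in $\mathcal C^\pm$ are $\psi_{i,\rho}=\iota(t_i^*)v_i$ with $t_i\in\mathrm{Hom}(\rho,\theta_i)$. Then, for either sign, the relative commutant $\iota(\mathcal A)'\cap\mathcal C^\pm$ is the linear span of all operators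 $\psi_{1,\rho}^*\psi_{2,\rho}$, where $\rho$ is an irreducible DHR endomorphism with $\rho\prec\theta_1$ and $\rho\prec\theta_2$, and $\psi_{i,\rho}$ are charged fields as above. If both $A_1$ and $A_2$ are commutative (hence the extensions $\mathcal B_1$ and $\mathcal B_2$ are local), then for either sign $\iota(\mathcal A)'\cap\mathcal C^\pm$ coincides with the centre $\mathcal C^{\pm\prime}\cap\mathcal C^\pm$. -/

import Mathlib

/-! ## Regions of the light ray and of two-dimensional Minkowski spacetime -/

/-- The two kinds of spacetime: a light ray `ℝ` (chiral theories), and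
two-dimensional Minkowski spacetime. -/
inductive Spacetime
  | chiral
  | minkowski

/-- Nonempty bounded open intervals `(a, b)` of the real line. -/
structure OpenInterval where
  left : ℝ
  right : ℝ
  left_lt_right : left < right

namespace OpenInterval

/-- Inclusion of intervals. -/
def Sub (I J : OpenInterval) : Prop := J.left ≤ I.left ∧ I.right ≤ J.right

/-- `I < J`: every point of `I` lies strictly before every point of `J`. -/
def Before (I J : OpenInterval) : Prop := I.right ≤ J.left

end OpenInterval

/-- Localization regions: bounded open intervals in the chiral case; in the Minkowski case
the double cones `I × J = {(t, x) : t + x ∈ I, t - x ∈ J}`, encoded by the pair `(I, J)`. -/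
def Region : Spacetime → Type
  | .chiral => OpenInterval
  | .minkowski => OpenInterval × OpenInterval

namespace Region

/-- Inclusion of regions. -/
def Sub : {S : Spacetime} → Region S → Region S → Prop
  | .chiral, I, J => OpenInterval.Sub I J
  | .minkowski, O, P => OpenInterval.Sub O.1 P.1 ∧ OpenInterval.Sub O.2 P.2

/-- `O.LeftOf P`: chiral case, `O` lies in the past of `P`; Minkowski case, `O` lies in the
spacelike left of `P`, that is `t + x < t' + x'` and `t - x > t' - x'` for all `(t, x) ∈ O`,
`(t', x') ∈ P`. -/
def LeftOf : {S : Spacetime} → Region S → Region S → Prop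
  | .chiral, I, J => OpenInterval.Before I J
  | .minkowski, O, P => OpenInterval.Before O.1 P.1 ∧ OpenInterval.Before P.2 O.2

/-- `O` is contained in the causal complement of `P` (which has two connected components). -/
def Separated {S : Spacetime} (O P : Region S) : Prop := O.LeftOf P ∨ P.LeftOf O

/-- The interval `(0, 1)`. -/
def unitInterval : OpenInterval := ⟨0, 1, by norm_num⟩

/-- The interval `(2, 3)`. -/
def shiftedInterval : OpenInterval := ⟨2, 3, by norm_num⟩

/-- An auxiliary region, which lies to the left of `Region.refRight`. -/
def refLeft : (S : Spacetime) → Region S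
  | .chiral => unitInterval
  | .minkowski => (unitInterval, shiftedInterval)

/-- An auxiliary region, which lies to the right of `Region.refLeft`. -/
def refRight : (S : Spacetime) → Region S
  | .chiral => shiftedInterval
  | .minkowski => (shiftedInterval, unitInterval)

theorem refLeft_leftOf_refRight (S : Spacetime) : (refLeft S).LeftOf (refRight S) := by
  cases S <;>
    norm_num [LeftOf, refLeft, refRight, OpenInterval.Before, unitInterval, shiftedInterval]

end Region

/-! ## Intertwiners, algebra objects and their extensions -/

section Algebraic

variable {A : Type*} [Ring A] [StarRing A] [Algebra ℂ A]

/-- The intertwiners `t : ρ → σ`, i.e. `t ρ(a) = σ(a) t` for all `a`. -/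
def Intertwiners (ρ σ : A →⋆ₐ[ℂ] A) : Set A := {t | ∀ a, t * ρ a = σ a * t}

/-- `ρ` is irreducible: its self-intertwiners are the multiples of `1`. -/
def IsIrreducibleEndo (ρ : A →⋆ₐ[ℂ] A) : Prop :=
  ∀ t ∈ Intertwiners ρ ρ, ∃ c : ℂ, t = c • (1 : A)

/-- `ρ ≺ θ`: there is an isometric intertwiner `ρ → θ`. -/
def IsSubEndo (ρ θ : A →⋆ₐ[ℂ] A) : Prop := ∃ s ∈ Intertwiners ρ θ, star s * s = 1

variable (A) in
/-- The data `(θ, w, x)` of an endomorphism and two operators. -/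
structure AlgTriple where
  θ : A →⋆ₐ[ℂ] A
  w : A
  x : A

/-- `w : id → θ` and `x : θ → θ²` are intertwiners with the unit property, associativity
and the Frobenius property. -/
structure AlgTriple.IsFrobenius (T : AlgTriple A) : Prop where
  w_mem : T.w ∈ Intertwiners (StarAlgHom.id ℂ A) T.θ
  x_mem : T.x ∈ Intertwiners T.θ (T.θ.comp T.θ)
  unit_left : star T.w * T.x = 1
  unit_right : T.θ (star T.w) * T.x = 1
  assoc : T.x * T.x = T.θ T.x * T.x
  frobenius : T.x * star T.x = T.θ (star T.x) * T.x

/-- The extension `B = ι(A) v` of `A` described by `T = (θ, w, x)`. Every element has a unique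
expression `ι(a) v` with `a : A`, so the underlying space is that of `A`, the element `a`
standing for `ι(a) v`. The operations below are those which the relations
`v ι(a) = ι(θ(a)) v`, `v v = ι(x) v`, `v* = ι(w* x*) v`, `1 = ι(w*) v` prescribe. -/
def Extension (_T : AlgTriple A) : Type _ := A

namespace Extension

variable (T : AlgTriple A)

instance : AddCommGroup (Extension T) := inferInstanceAs (AddCommGroup A)

instance : Module ℂ (Extension T) := inferInstanceAs (Module ℂ A)

/-- The element `ι(a) v`. -/
def mk : A ≃ₗ[ℂ] Extension T := LinearEquiv.refl ℂ A

/-- `ι(a) v · ι(b) v = ι(a θ(b) x) v`. -/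
instance : Mul (Extension T) :=
  ⟨fun b c => mk T ((mk T).symm b * T.θ ((mk T).symm c) * T.x)⟩

/-- `1 = ι(w*) v`. -/
instance : One (Extension T) := ⟨mk T (star T.w)⟩

/-- `(ι(a) v)* = v* ι(a*) = ι(w* x* θ(a*)) v`. -/
instance : Star (Extension T) :=
  ⟨fun b => mk T (star T.w * star T.x * T.θ (star ((mk T).symm b)))⟩

/-- The embedding `ι : A → B`, `ι(a) = ι(a) 1 = ι(a w*) v`. -/
def ι (a : A) : Extension T := mk T (a * star T.w)

/-- The generator `v`. -/
def v : Extension T := mk T 1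

/-- The relative commutant `ι(A)' ∩ B`. -/
def relativeCommutant : Set (Extension T) := Set.centralizer (Set.range (ι T))

/-- The centre `B' ∩ B`. -/
def centre : Set (Extension T) := Set.centralizer Set.univ

variable {T}

theorem mk_mul_mk (a b : A) : mk T a * mk T b = mk T (a * T.θ b * T.x) := rfl

theorem star_mk (a : A) : star (mk T a) = mk T (star T.w * star T.x * T.θ (star a)) := rfl

/-- For triples with the above relations `B` is a unital algebra, `ι` is a unital homomorphism
and `v` satisfies the defining relations. -/
theorem ring_laws (h : T.IsFrobenius) :
    (∀ b c e : Extension T, b * c * e = b * (c * e)) ∧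
    (∀ b : Extension T, 1 * b = b) ∧ (∀ b : Extension T, b * 1 = b) ∧
    (∀ a b, ι T (a * b) = ι T a * ι T b) ∧ ι T 1 = 1 ∧
    (∀ a, ι T a * v T = mk T a) ∧ (∀ a, v T * ι T a = ι T (T.θ a) * v T) ∧
    v T * v T = ι T T.x * v T ∧ ι T (star T.w) * v T = 1 ∧
    star (v T) = ι T (star T.w * star T.x) * v T := by
  have hw : ∀ a, star T.w * T.θ a = a * star T.w := by
    intro a
    have := congrArg star (h.w_mem (star a))
    simpa [← map_star] using this.symm
  have hx : ∀ a, T.x * T.θ a = T.θ (T.θ a) * T.x := fun a => h.x_mem a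
  have key : ∀ a b, ι T a * mk T b = mk T (a * b) := by
    intro a b
    rw [ι, mk_mul_mk, mul_assoc a, hw, ← mul_assoc, mul_assoc _ _ T.x, h.unit_left, mul_one]
  have keyv : ∀ a, ι T a * v T = mk T a := fun a => by rw [v, key, mul_one]
  refine ⟨?_, ?_, ?_, ?_, ?_, keyv, ?_, ?_, ?_, ?_⟩
  · intro b c e
    obtain ⟨b, rfl⟩ := (mk T).surjective b
    obtain ⟨c, rfl⟩ := (mk T).surjective c
    obtain ⟨e, rfl⟩ := (mk T).surjective e
    simp only [mk_mul_mk]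
    congr 1
    simp only [map_mul, mul_assoc]
    rw [← mul_assoc T.x, hx, mul_assoc, h.assoc]
  · intro b
    obtain ⟨b, rfl⟩ := (mk T).surjective b
    change mk T (star T.w) * mk T b = mk T b
    rw [mk_mul_mk, hw, mul_assoc, h.unit_left, mul_one]
  · intro b
    obtain ⟨b, rfl⟩ := (mk T).surjective b
    change mk T b * mk T (star T.w) = mk T b
    rw [mk_mul_mk, mul_assoc, h.unit_right, mul_one]
  · intro a b
    conv_rhs => rw [show ι T b = mk T (b * star T.w) from rfl, key]
    rw [ι, mul_assoc]
  · rw [ι, one_mul]; rfl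
  · intro a
    rw [keyv, show ι T a = mk T (a * star T.w) from rfl, v, mk_mul_mk, one_mul, map_mul T.θ, mul_assoc, h.unit_right, mul_one]
  · rw [keyv, v, mk_mul_mk, map_one, one_mul, one_mul]
  · rw [keyv]; rfl
  · rw [keyv, v, star_mk, star_one, map_one, mul_one]

/-- For triples with the above relations, `*` is an involution on `B`, and `ι` preserves it. -/
theorem star_laws (h : T.IsFrobenius) :
    (∀ b : Extension T, star (star b) = b) ∧
    (∀ b c : Extension T, star (b * c) = star c * star b) ∧
    (∀ a, ι T (star a) = star (ι T a)) := by
  have hw : ∀ a, star T.w * T.θ a = a * star T.w := by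
    intro a
    have := congrArg star (h.w_mem (star a))
    simpa [← map_star] using this.symm
  have hx : ∀ a, T.x * T.θ a = T.θ (T.θ a) * T.x := fun a => h.x_mem a
  have hx' : ∀ a, star T.x * T.θ (T.θ a) = T.θ a * star T.x := by
    intro a
    have := congrArg star (h.x_mem (star a))
    simpa [← map_star] using this.symm
  have ha' : star T.x * star T.x = star T.x * T.θ (star T.x) := by
    have := congrArg star h.assoc
    simpa [← map_star] using this
  have hf' : T.x * star T.x = star T.x * T.θ T.x := by
    have := congrArg star h.frobenius
    simpa [← map_star] using this
  have hu' : star T.x * T.θ T.w = 1 := by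
    have := congrArg star h.unit_right
    simpa [← map_star] using this
  have hu : star T.x * T.w = 1 := by
    have := congrArg star h.unit_left
    simpa [← map_star] using this
  refine ⟨?_, ?_, ?_⟩
  · intro b
    obtain ⟨b, rfl⟩ := (mk T).surjective b
    rw [star_mk, star_mk]
    congr 1
    have e1 : star (star T.w * star T.x * T.θ (star b))
        = T.θ b * T.x * T.w := by simp [← map_star, mul_assoc]
    rw [e1]
    calc star T.w * star T.x * T.θ (T.θ b * T.x * T.w)
        = star T.w * (star T.x * T.θ (T.θ b)) * T.θ T.x * T.θ T.w := by
          simp only [map_mul, mul_assoc]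
      _ = (star T.w * T.θ b) * (star T.x * T.θ T.x) * T.θ T.w := by
          rw [hx']; simp only [mul_assoc]
      _ = b * ((star T.w * T.x) * (star T.x * T.θ T.w)) := by
          rw [hw, ← hf']; simp only [mul_assoc]
      _ = b := by rw [h.unit_left, hu']; simp
  · intro b c
    obtain ⟨b, rfl⟩ := (mk T).surjective b
    obtain ⟨c, rfl⟩ := (mk T).surjective c
    simp only [star_mk, mk_mul_mk]
    congr 1
    have e1 : star (b * T.θ c * T.x)
        = star T.x * (T.θ (star c) * star b) := by simp [← map_star, mul_assoc]
    rw [e1]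
    symm
    calc star T.w * star T.x * T.θ (star c) *
          T.θ (star T.w * star T.x * T.θ (star b)) * T.x
        = star T.w * star T.x * T.θ (star c) * T.θ (star T.w) *
          T.θ (star T.x) * (T.θ (T.θ (star b)) * T.x) := by
          simp only [map_mul, mul_assoc]
      _ = star T.w * star T.x * T.θ (star c) * T.θ (star T.w) *
          (T.θ (star T.x) * T.x) * T.θ (star b) := by
          rw [← hx]; simp only [mul_assoc]
      _ = star T.w * star T.x * T.θ (star c) * (T.θ (star T.w) *
          T.x) * star T.x * T.θ (star b) := by
          rw [← h.frobenius]; simp only [mul_assoc]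
      _ = star T.w * star T.x * (T.θ (star c) * star T.x) * T.θ (star b) := by
          rw [h.unit_right]; simp only [mul_assoc, mul_one]
      _ = star T.w * (star T.x * star T.x) * T.θ (T.θ (star c)) * T.θ (star b) := by
          rw [← hx']; simp only [mul_assoc]
      _ = star T.w * star T.x * T.θ (star T.x * (T.θ (star c) * star b)) := by
          rw [ha']; simp only [map_mul, mul_assoc]
  · intro a
    rw [ι, ι, star_mk]
    congr 1
    rw [star_mul, star_star, map_mul, mul_assoc (star T.w), ← mul_assoc (star T.x), hu', one_mul, hw]

end Extension

end Algebraic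

/-! ## Nets of von Neumann algebras and DHR endomorphisms -/

section Net

variable {H : Type*} [NormedAddCommGroup H] [InnerProductSpace ℂ H] [CompleteSpace H]

/-- `N` is a factor of type III, in the form appropriate for countably decomposable algebras:
`N` is a factor, not reduced to the scalars, and every nonzero projection `e` of `N` is
equivalent to `1` in `N`, that is `e = s s*` with an isometry `s ∈ N`. -/
structure IsTypeIIIFactor (N : VonNeumannAlgebra H) : Prop where
  factor : ∀ z ∈ N, (∀ a ∈ N, a * z = z * a) → ∃ c : ℂ, z = c • (1 : H →L[ℂ] H)
  not_scalar : ∃ a ∈ N, ∀ c : ℂ, a ≠ c • (1 : H →L[ℂ] H)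
  equiv_one : ∀ e ∈ N, IsStarProjection e → e ≠ 0 → ∃ s ∈ N, s * star s = e ∧ star s * s = 1

variable (H) in
/-- A local, Haag dual net `O ↦ 𝔄(O)` of type III factors on a Hilbert space `H`. -/
structure LocalNet (S : Spacetime) where
  alg : Region S → VonNeumannAlgebra H
  isotony : ∀ O P : Region S, O.Sub P → ∀ a ∈ alg O, a ∈ alg P
  locality : ∀ O P : Region S, O.Separated P → ∀ a ∈ alg O, ∀ b ∈ alg P, a * b = b * a
  /-- Haag duality `𝔄(O) = 𝔄(O')'`, with `𝔄(O')` generated by the `𝔄(P)`, `P ⊆ O'`. -/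
  haag_duality : ∀ (O : Region S) (a : H →L[ℂ] H),
    (∀ P : Region S, P.Separated O → ∀ b ∈ alg P, a * b = b * a) → a ∈ alg O
  typeIII : ∀ O : Region S, IsTypeIIIFactor (alg O)

variable {S : Spacetime}

namespace LocalNet

/-- The algebra of observables: the C*-algebra generated by all local algebras. -/
noncomputable def quasiLocal (𝔄 : LocalNet H S) : StarSubalgebra ℂ (H →L[ℂ] H) :=
  (⨆ O : Region S, (𝔄.alg O).toStarSubalgebra).topologicalClosure

/-- The algebra of observables as a type. -/
abbrev Obs (𝔄 : LocalNet H S) : Type _ := 𝔄.quasiLocal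

/-- The observable `a` belongs to the local algebra `𝔄(O)`. -/
def IsLocalObs (𝔄 : LocalNet H S) (O : Region S) (a : 𝔄.Obs) : Prop :=
  (a : H →L[ℂ] H) ∈ 𝔄.alg O

/-- The unitary `u` carries `ρ` into the region `O`: the endomorphism `Ad_u ρ` is localized in
`O`, i.e. it acts trivially on `𝔄(P)` for all `P ⊆ O'`. -/
def Transports (𝔄 : LocalNet H S) (ρ : 𝔄.Obs →⋆ₐ[ℂ] 𝔄.Obs) (O : Region S) (u : 𝔄.Obs) : Prop :=
  u ∈ unitary 𝔄.Obs ∧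
    ∀ P : Region S, P.Separated O → ∀ a : 𝔄.Obs, 𝔄.IsLocalObs P a → u * ρ a * star u = a

end LocalNet

/-- DHR endomorphisms: unital *-endomorphisms of the algebra of observables which are localized
in some region, and which can be transported to every other region by a unitary. -/
structure DHREndo (𝔄 : LocalNet H S) where
  toHom : 𝔄.Obs →⋆ₐ[ℂ] 𝔄.Obs
  localized : ∃ O : Region S, 𝔄.Transports toHom O 1
  transportable : ∀ O : Region S, ∃ u : 𝔄.Obs, 𝔄.Transports toHom O u

namespace DHREndo

variable {𝔄 : LocalNet H S}

/-- A unitary charge transporter carrying `ρ` into the region `O`. -/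
noncomputable def transporter (ρ : DHREndo 𝔄) (O : Region S) : 𝔄.Obs :=
  Classical.choose (ρ.transportable O)

/-- The statistics operator (braiding)
`ε_{ρ,σ} = σ(u_ρ*) u_σ* u_ρ ρ(u_σ) : ρσ → σρ`, with unitaries `u_ρ`, `u_σ` such that `Ad_{u_σ} σ`
is localized to the left (in the past) of `Ad_{u_ρ} ρ`. -/
noncomputable def braiding (ρ σ : DHREndo 𝔄) : 𝔄.Obs :=
  σ.toHom (star (ρ.transporter (Region.refRight S))) * star (σ.transporter (Region.refLeft S)) *
    ρ.transporter (Region.refRight S) * ρ.toHom (σ.transporter (Region.refLeft S))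

/-- `w : id → ρ' ρ` and `v : id → ρ ρ'` solve the conjugacy relations for the pair `ρ`, `ρ'`
with `w* w = v* v = d`. -/
structure IsConjugateSolution (ρ ρ' : DHREndo 𝔄) (d : ℝ) (w v : 𝔄.Obs) : Prop where
  w_mem : w ∈ Intertwiners (StarAlgHom.id ℂ 𝔄.Obs) (ρ'.toHom.comp ρ.toHom)
  v_mem : v ∈ Intertwiners (StarAlgHom.id ℂ 𝔄.Obs) (ρ.toHom.comp ρ'.toHom)
  conj_left : star v * ρ.toHom w = 1
  conj_right : star w * ρ'.toHom v = 1
  norm_w : star w * w = (d : ℂ) • (1 : 𝔄.Obs)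
  norm_v : star v * v = (d : ℂ) • (1 : 𝔄.Obs)

/-- The values `d` of the normalized solutions of the conjugacy relations for `ρ`. -/
def conjugateValues (ρ : DHREndo 𝔄) : Set ℝ :=
  {d | ∃ (ρ' : DHREndo 𝔄) (w v : 𝔄.Obs), IsConjugateSolution ρ ρ' d w v}

/-- `ρ` has finite (statistical) dimension: it has a conjugate. -/
def HasFiniteDim (ρ : DHREndo 𝔄) : Prop := ρ.conjugateValues.Nonempty

/-- The dimension of an endomorphism of finite dimension. -/
noncomputable def dim (ρ : DHREndo 𝔄) : ℝ := sInf ρ.conjugateValues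

end DHREndo

/-- A Q-system `(θ, w, x)` in the category of DHR endomorphisms of finite dimension. -/
structure QSystem (𝔄 : LocalNet H S) where
  θ : DHREndo 𝔄
  w : 𝔄.Obs
  x : 𝔄.Obs
  finite_dim : θ.HasFiniteDim
  isFrobenius : (AlgTriple.mk θ.toHom w x).IsFrobenius
  standard_w : star w * w = (Real.sqrt θ.dim : ℂ) • (1 : 𝔄.Obs)
  standard_x : star x * x = (Real.sqrt θ.dim : ℂ) • (1 : 𝔄.Obs)

/-- The choice of the braiding `ε⁺` or of the opposite braiding `ε⁻`. -/
inductive BraidSign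
  | plus
  | minus

/-- `ε⁺_{ρ,σ} = ε_{ρ,σ}` and `ε⁻_{ρ,σ} = (ε_{σ,ρ})*`. -/
noncomputable def signedBraiding {𝔄 : LocalNet H S} : BraidSign → (ρ σ : DHREndo 𝔄) → 𝔄.Obs
  | .plus, ρ, σ => ρ.braiding σ
  | .minus, ρ, σ => star (σ.braiding ρ)

namespace QSystem

variable {𝔄 : LocalNet H S}

/-- The underlying triple. -/
def toTriple (Q : QSystem 𝔄) : AlgTriple 𝔄.Obs := ⟨Q.θ.toHom, Q.w, Q.x⟩

/-- The Q-system is commutative: `ε_{θ,θ} x = x`. -/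
def IsCommutative (Q : QSystem 𝔄) : Prop := Q.θ.braiding Q.θ * Q.x = Q.x

/-- The local algebra `B(O) = ι(𝔄(O)) v̂` of the extension `B`, where `v̂ = ι(u) v` with a unitary
`u` such that `Ad_u θ` is localized in `O`. -/
def localAlg (Q : QSystem 𝔄) (O : Region S) : Set (Extension Q.toTriple) :=
  {b | ∃ a u : 𝔄.Obs, 𝔄.IsLocalObs O a ∧ 𝔄.Transports Q.θ.toHom O u ∧
    b = Extension.ι Q.toTriple a * (Extension.ι Q.toTriple u * Extension.v Q.toTriple)}

/-- The extension `B` is local: `B(O)` and `B(P)` commute for causally separated `O`, `P`. -/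
def IsLocalExtension (Q : QSystem 𝔄) : Prop :=
  ∀ O P : Region S, O.Separated P → ∀ b ∈ Q.localAlg O, ∀ c ∈ Q.localAlg P, b * c = c * b

/-- The braided product
`A₁ ×^± A₂ = (θ₁ θ₂, θ₁(w₂) w₁, θ₁(ε^±_{θ₁,θ₂}) x₁ θ₁(x₂))`. -/
noncomputable def braidedProduct (s : BraidSign) (A₁ A₂ : QSystem 𝔄) : AlgTriple 𝔄.Obs where
  θ := A₁.θ.toHom.comp A₂.θ.toHom
  w := A₁.θ.toHom A₂.w * A₁.w
  x := A₁.θ.toHom (signedBraiding s A₁.θ A₂.θ) * A₁.x * A₁.θ.toHom A₂.x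

/-- The braided product extension `C^± = B₁ ×^± B₂`. -/
abbrev ProductExtension (s : BraidSign) (A₁ A₂ : QSystem 𝔄) : Type _ :=
  Extension (braidedProduct s A₁ A₂)

/-- The generator `v₁ = ι(θ₁(w₂*)) v` of the intermediate extension `B₁ ⊆ C^±`. -/
noncomputable def v₁ (s : BraidSign) (A₁ A₂ : QSystem 𝔄) : ProductExtension s A₁ A₂ :=
  Extension.ι _ (A₁.θ.toHom (star A₂.w)) * Extension.v _

/-- The generator `v₂ = ι(w₁*) v` of the intermediate extension `B₂ ⊆ C^±`. -/
noncomputable def v₂ (s : BraidSign) (A₁ A₂ : QSystem 𝔄) : ProductExtension s A₁ A₂ :=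
  Extension.ι _ (star A₁.w) * Extension.v _

/-- The charged field `ψ_{1,ρ} = ι(t*) v₁` of `B₁` in `C^±`, for an intertwiner `t : ρ → θ₁`. -/
noncomputable def ψ₁ (s : BraidSign) (A₁ A₂ : QSystem 𝔄) (t : 𝔄.Obs) :
    ProductExtension s A₁ A₂ :=
  Extension.ι _ (star t) * v₁ s A₁ A₂

/-- The charged field `ψ_{2,ρ} = ι(t*) v₂` of `B₂` in `C^±`, for an intertwiner `t : ρ → θ₂`. -/
noncomputable def ψ₂ (s : BraidSign) (A₁ A₂ : QSystem 𝔄) (t : 𝔄.Obs) :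
    ProductExtension s A₁ A₂ :=
  Extension.ι _ (star t) * v₂ s A₁ A₂

/-- The operators `ψ_{1,ρ}* ψ_{2,ρ}`, where `ρ` is an irreducible DHR endomorphism with
`ρ ≺ θ₁` and `ρ ≺ θ₂`, and `ψ_{1,ρ}`, `ψ_{2,ρ}` are charged fields of `B₁` and `B₂`. -/
def neutralProducts (s : BraidSign) (A₁ A₂ : QSystem 𝔄) : Set (ProductExtension s A₁ A₂) :=
  {b | ∃ ρ : DHREndo 𝔄, IsIrreducibleEndo ρ.toHom ∧
    IsSubEndo ρ.toHom A₁.θ.toHom ∧ IsSubEndo ρ.toHom A₂.θ.toHom ∧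
    ∃ t₁ ∈ Intertwiners ρ.toHom A₁.θ.toHom, ∃ t₂ ∈ Intertwiners ρ.toHom A₂.θ.toHom,
      b = star (ψ₁ s A₁ A₂ t₁) * ψ₂ s A₁ A₂ t₂}

end QSystem

end Net

/-! ## Intertwiners and braided products of algebra objects in a `*`-algebra -/

section Algebraic

variable {A : Type*} [Ring A] [StarRing A] [Algebra ℂ A]

/-! Everything is translated into intertwiners of observables. Elements of the braided product have
unique coefficients `a` in `ι(a)v`, and `ι(a)v` commutes with `ι(𝔄)` exactly when `a : θ₁θ₂ → id`
(`mk_mem_relativeCommutant`). The Q-system makes `θ₁` its own conjugate through `x₁w₁`, so Frobenius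
reciprocity writes these `a` as `w₁* x₁* θ₁(t)` with `t : θ₂ → θ₁` (`mem_intertwiners_comp_iff`). A
direct computation shows that `ψ₁* ψ₂` has the coefficient with `t = t₁ t₂*`
(`star_field_mul_field`).

The first claim thus says that the operators `t₁ t₂*` factoring through irreducibles span the
intertwiners `θ₂ → θ₁`. This follows from complete reducibility of `θ₁`
(`one_mem_span_irreducibleProjections`): conjugacy makes the commutant of `θ₁` finite dimensional
(`finiteDimensional_intertwiners`), a reducible endomorphism then has a nontrivial projection in its
commutant (`exists_projection`), and Haag duality with the type III property turns it into a DHR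
subobject (`DHREndo.exists_sub`).

For the centre, `ι(a)v` in the relative commutant is central as soon as `a x = θ(a) x`. Naturality
of the braiding moves `a : θ₁θ₂ → id` past `θ₁` and past `θ₂`; this costs self-braidings of `θ₁` and
`θ₂`, which commutativity lets `x₁` and `x₂` absorb (`mul_braided_x`). -/

theorem Intertwiners.star_mem {ρ σ : A →⋆ₐ[ℂ] A} {t : A} (ht : t ∈ Intertwiners ρ σ) :
    star t ∈ Intertwiners σ ρ := by
  intro a
  have := congrArg star (ht (star a))
  simpa [← map_star] using this.symm

theorem Intertwiners.mul_mem {ρ σ τ : A →⋆ₐ[ℂ] A} {s t : A} (hs : s ∈ Intertwiners σ τ)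
    (ht : t ∈ Intertwiners ρ σ) : s * t ∈ Intertwiners ρ τ := by
  intro a
  rw [mul_assoc, ht a, ← mul_assoc, hs a, mul_assoc]

theorem Intertwiners.map_mem {ρ σ : A →⋆ₐ[ℂ] A} (τ : A →⋆ₐ[ℂ] A) {t : A}
    (ht : t ∈ Intertwiners ρ σ) : τ t ∈ Intertwiners (τ.comp ρ) (τ.comp σ) := by
  intro a
  simp only [StarAlgHom.comp_apply, ← map_mul, ht a]

/-- The intertwiners `ρ → σ` as a linear subspace. -/
def intertwinerSubmodule (ρ σ : A →⋆ₐ[ℂ] A) : Submodule ℂ A where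
  carrier := Intertwiners ρ σ
  add_mem' {s t} hs ht a := by rw [add_mul, mul_add, hs a, ht a]
  zero_mem' a := by rw [zero_mul, mul_zero]
  smul_mem' c t ht a := by rw [smul_mul_assoc, mul_smul_comm, ht a]

namespace AlgTriple.IsFrobenius

variable {T : AlgTriple A}

theorem star_w_mul (h : T.IsFrobenius) (a : A) : star T.w * T.θ a = a * star T.w :=
  Intertwiners.star_mem h.w_mem a

theorem star_x_mul (h : T.IsFrobenius) (a : A) : star T.x * T.θ (T.θ a) = T.θ a * star T.x :=
  Intertwiners.star_mem h.x_mem a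

theorem star_x_mul_map_w (h : T.IsFrobenius) : star T.x * T.θ T.w = 1 := by
  have := congrArg star h.unit_right
  simpa [← map_star] using this

theorem star_x_mul_map_x (h : T.IsFrobenius) : star T.x * T.θ T.x = T.x * star T.x := by
  have := congrArg star h.frobenius
  simpa [← map_star] using this.symm

theorem x_mul_w_mem (h : T.IsFrobenius) :
    T.x * T.w ∈ Intertwiners (StarAlgHom.id ℂ A) (T.θ.comp T.θ) :=
  Intertwiners.mul_mem h.x_mem h.w_mem

/-- The intertwiner `x w : id → θ²` solves the conjugacy equation. -/
theorem star_x_mul_w_mul_map (h : T.IsFrobenius) : star (T.x * T.w) * T.θ (T.x * T.w) = 1 := by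
  calc star (T.x * T.w) * T.θ (T.x * T.w)
      = star T.w * (star T.x * T.θ T.x) * T.θ T.w := by simp only [star_mul, map_mul, mul_assoc]
    _ = (star T.w * T.x) * (star T.x * T.θ T.w) := by
        rw [h.star_x_mul_map_x]; simp only [mul_assoc]
    _ = 1 := by rw [h.unit_left, h.star_x_mul_map_w, one_mul]

end AlgTriple.IsFrobenius

/-- The braided product of two triples by means of `e : θ₁ θ₂ → θ₂ θ₁`. -/
def AlgTriple.braided (T₁ T₂ : AlgTriple A) (e : A) : AlgTriple A :=
  ⟨T₁.θ.comp T₂.θ, T₁.θ T₂.w * T₁.w, T₁.θ e * T₁.x * T₁.θ T₂.x⟩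

/-- `e : θ₁ θ₂ → θ₂ θ₁` is a unitary intertwiner which is natural with respect to the
units `w₁` and `w₂`. -/
structure AlgTriple.IsUnitBraiding (T₁ T₂ : AlgTriple A) (e : A) : Prop where
  mem : e ∈ Intertwiners (T₁.θ.comp T₂.θ) (T₂.θ.comp T₁.θ)
  star_mul_self : star e * e = 1
  mul_star_self : e * star e = 1
  mul_w₁ : e * T₁.w = T₂.θ T₁.w
  mul_map_w₂ : e * T₁.θ T₂.w = T₂.w

namespace AlgTriple.IsUnitBraiding

variable {T₁ T₂ : AlgTriple A} {e : A}

theorem star_w₁_eq (he : T₁.IsUnitBraiding T₂ e) : T₂.θ (star T₁.w) * e = star T₁.w := by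
  have : star T₁.w * star e = T₂.θ (star T₁.w) := by
    rw [← star_mul, he.mul_w₁, map_star]
  rw [← this, mul_assoc, he.star_mul_self, mul_one]

theorem star_w₂_mul_star (he : T₁.IsUnitBraiding T₂ e) : T₁.θ (star T₂.w) * star e = star T₂.w := by
  rw [map_star, ← star_mul, he.mul_map_w₂]

theorem star_w₂_eq (he : T₁.IsUnitBraiding T₂ e) : star T₂.w * e = T₁.θ (star T₂.w) := by
  conv_lhs => rw [← he.star_w₂_mul_star]
  rw [mul_assoc, he.star_mul_self, mul_one]

end AlgTriple.IsUnitBraiding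

/-! ### Commutation with `ι(𝔄)` and centrality as conditions on coefficients. -/

namespace Extension

/-- The relations of a triple on which the unit and bimodule properties of its extension rest. -/
structure _root_.AlgTriple.IsUnital (T : AlgTriple A) : Prop where
  star_w_mul : ∀ a, star T.w * T.θ a = a * star T.w
  unit_left : star T.w * T.x = 1
  unit_right : T.θ (star T.w) * T.x = 1

variable {T : AlgTriple A}

theorem _root_.AlgTriple.IsFrobenius.isUnital (h : T.IsFrobenius) : T.IsUnital :=
  ⟨h.star_w_mul, h.unit_left, h.unit_right⟩

theorem ι_mul_mk (h : T.IsUnital) (a b : A) : ι T a * mk T b = mk T (a * b) := by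
  rw [ι, mk_mul_mk, mul_assoc a, h.star_w_mul, ← mul_assoc, mul_assoc _ _ T.x, h.unit_left, mul_one]

theorem mk_mul_ι (h : T.IsUnital) (a b : A) : mk T a * ι T b = mk T (a * T.θ b) := by
  rw [ι, mk_mul_mk, map_mul T.θ, mul_assoc, mul_assoc, h.unit_right, mul_one]

/-- Both products with `ι(b)` have an explicit coefficient, `b a` and `a θ(b)`; uniqueness of
coefficients turns commutation into the intertwiner relation. -/
theorem mk_mem_relativeCommutant (h : T.IsUnital) (a : A) :
    mk T a ∈ relativeCommutant T ↔ a ∈ Intertwiners T.θ (StarAlgHom.id ℂ A) := by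
  rw [relativeCommutant, Set.mem_centralizer_iff]
  constructor
  · intro H b
    have := H _ ⟨b, rfl⟩
    rw [ι_mul_mk h, mk_mul_ι h] at this
    exact ((mk T).injective this).symm
  · rintro H _ ⟨b, rfl⟩
    rw [ι_mul_mk h, mk_mul_ι h, H b]
    rfl

/-- The relative commutant as a linear subspace. -/
def relativeCommutantSubmodule (h : T.IsUnital) : Submodule ℂ (Extension T) where
  carrier := relativeCommutant T
  add_mem' {b c} hb hc := by
    obtain ⟨b, rfl⟩ := (mk T).surjective b
    obtain ⟨c, rfl⟩ := (mk T).surjective c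
    rw [← map_add]
    rw [mk_mem_relativeCommutant h] at *
    exact (intertwinerSubmodule T.θ (StarAlgHom.id ℂ A)).add_mem hb hc
  zero_mem' := by
    rw [← map_zero (mk T), mk_mem_relativeCommutant h]
    exact (intertwinerSubmodule T.θ (StarAlgHom.id ℂ A)).zero_mem
  smul_mem' c b hb := by
    obtain ⟨b, rfl⟩ := (mk T).surjective b
    rw [← map_smul]
    rw [mk_mem_relativeCommutant h] at *
    exact (intertwinerSubmodule T.θ (StarAlgHom.id ℂ A)).smul_mem c hb

theorem centre_subset_relativeCommutant (T : AlgTriple A) : centre T ⊆ relativeCommutant T :=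
  Set.centralizer_subset (Set.subset_univ _)

/-- The products with `ι(b)v` in the two orders have coefficients `a θ(b) x = b a x` and `b θ(a) x`,
so a condition free of `b` suffices. -/
theorem mk_mem_centre {a : A} (ha : a ∈ Intertwiners T.θ (StarAlgHom.id ℂ A))
    (hx : a * T.x = T.θ a * T.x) : mk T a ∈ centre T := by
  rw [centre, Set.mem_centralizer_iff]
  intro b _
  obtain ⟨b, rfl⟩ := (mk T).surjective b
  rw [mk_mul_mk, mk_mul_mk, ha b, mul_assoc, ← hx, mul_assoc]
  rfl

end Extension

/-! ### Braided products: unit laws, Frobenius reciprocity, products of fields, central elements. -/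

namespace AlgTriple

variable {T₁ T₂ : AlgTriple A} {e : A}

theorem IsUnitBraiding.map_w₁_mul_x (he : T₁.IsUnitBraiding T₂ e) (h₁ : T₁.IsFrobenius) :
    T₁.θ (T₂.θ (star T₁.w)) * (T₁.braided T₂ e).x = T₁.θ T₂.x := by
  calc T₁.θ (T₂.θ (star T₁.w)) * (T₁.braided T₂ e).x
      = T₁.θ (T₂.θ (star T₁.w) * e) * T₁.x * T₁.θ T₂.x := by
        simp only [braided, map_mul, mul_assoc]
    _ = T₁.θ T₂.x := by rw [he.star_w₁_eq, h₁.unit_right, one_mul]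

/-- The unit laws need only naturality of `e` with respect to `w₁` and `w₂`. They suffice for the
computations in the product extension below; its associativity and Frobenius law do not enter. -/
theorem IsUnitBraiding.braided_isUnital (he : T₁.IsUnitBraiding T₂ e) (h₁ : T₁.IsFrobenius)
    (h₂ : T₂.IsFrobenius) : (T₁.braided T₂ e).IsUnital where
  star_w_mul a := by
    calc star (T₁.θ T₂.w * T₁.w) * T₁.θ (T₂.θ a)
        = star T₁.w * T₁.θ (star T₂.w * T₂.θ a) := by
          simp only [star_mul, map_mul, map_star, mul_assoc]
      _ = a * star (T₁.θ T₂.w * T₁.w) := by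
          rw [h₂.star_w_mul, h₁.star_w_mul, mul_assoc, ← h₁.star_w_mul, star_mul, map_star]
  unit_left := by
    calc star (T₁.θ T₂.w * T₁.w) * (T₁.θ e * T₁.x * T₁.θ T₂.x)
        = star T₁.w * T₁.θ (star T₂.w * e) * (T₁.x * T₁.θ T₂.x) := by
          simp only [star_mul, map_mul, map_star, mul_assoc]
      _ = T₁.θ (star T₂.w) * (star T₁.w * T₁.x) * T₁.θ T₂.x := by
          rw [he.star_w₂_eq, h₁.star_w_mul]; simp only [mul_assoc]
      _ = 1 := by rw [h₁.unit_left, mul_one, ← map_mul, h₂.unit_left, map_one]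
  unit_right := by
    calc T₁.θ (T₂.θ (star (T₁.θ T₂.w * T₁.w))) * (T₁.braided T₂ e).x
        = T₁.θ (T₂.θ (star T₁.w) * (T₂.θ (T₁.θ (star T₂.w)) * e)) *
            (T₁.x * T₁.θ T₂.x) := by
          simp only [braided, star_mul, map_mul, map_star, mul_assoc]
      _ = T₁.θ (T₂.θ (star T₁.w) * e) * (T₁.θ (T₁.θ (T₂.θ (star T₂.w))) * T₁.x) *
            T₁.θ T₂.x := by
          have : T₂.θ (T₁.θ (star T₂.w)) * e = e * T₁.θ (T₂.θ (star T₂.w)) :=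
            (he.mem (star T₂.w)).symm
          rw [this]; simp only [map_mul, mul_assoc]
      _ = T₁.θ (star T₁.w) * (T₁.x * T₁.θ (T₂.θ (star T₂.w))) * T₁.θ T₂.x := by
          rw [he.star_w₁_eq, h₁.x_mem]; rfl
      _ = T₁.θ (star T₁.w) * T₁.x * T₁.θ (T₂.θ (star T₂.w) * T₂.x) := by
          simp only [map_mul, mul_assoc]
      _ = 1 := by rw [h₁.unit_right, h₂.unit_right, map_one, one_mul]

/-- Frobenius reciprocity: the intertwiners `θ₁ θ₂ → id` are the operators `w₁* x₁* θ₁(t)` with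
`t : θ₂ → θ₁`. -/
theorem IsFrobenius.mem_intertwiners_comp_iff (h₁ : T₁.IsFrobenius) {σ : A →⋆ₐ[ℂ] A} {a : A} :
    a ∈ Intertwiners (T₁.θ.comp σ) (StarAlgHom.id ℂ A) ↔
      ∃ t ∈ Intertwiners σ T₁.θ, a = star T₁.w * star T₁.x * T₁.θ t := by
  constructor
  · intro ha
    -- The conjugacy solution `x₁ w₁ : id → θ₁²` bends the leg `θ₁` of `a` from source to target.
    refine ⟨T₁.θ a * (T₁.x * T₁.w), ?_, ?_⟩
    · intro b
      have h1 : T₁.x * T₁.w * σ b = T₁.θ (T₁.θ (σ b)) * (T₁.x * T₁.w) := h₁.x_mul_w_mem (σ b)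
      have h2 : a * T₁.θ (σ b) = b * a := ha b
      rw [mul_assoc, h1, ← mul_assoc, ← map_mul, h2, map_mul, mul_assoc]
    · symm
      calc star T₁.w * star T₁.x * T₁.θ (T₁.θ a * (T₁.x * T₁.w))
          = star T₁.w * (star T₁.x * T₁.θ (T₁.θ a)) * T₁.θ (T₁.x * T₁.w) := by
            simp only [map_mul, mul_assoc]
        _ = (star T₁.w * T₁.θ a) * star T₁.x * T₁.θ (T₁.x * T₁.w) := by
            rw [h₁.star_x_mul]; simp only [mul_assoc]
        _ = a * (star (T₁.x * T₁.w) * T₁.θ (T₁.x * T₁.w)) := by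
            rw [h₁.star_w_mul]; simp only [star_mul, mul_assoc]
        _ = a := by rw [h₁.star_x_mul_w_mul_map, mul_one]
  · rintro ⟨t, ht, rfl⟩ b
    have h1 : star (T₁.x * T₁.w) * T₁.θ (T₁.θ b) = b * star (T₁.x * T₁.w) :=
      Intertwiners.star_mem h₁.x_mul_w_mem b
    rw [star_mul] at h1
    change _ * T₁.θ (σ b) = b * _
    rw [mul_assoc, ← map_mul, ht b, map_mul, ← mul_assoc, h1, mul_assoc]

/-- The product `(ι(t₁*) v₁)* (ι(t₂*) v₂)` of charged fields in the braided product extension. -/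
theorem IsUnitBraiding.star_field_mul_field (he : T₁.IsUnitBraiding T₂ e) (h₁ : T₁.IsFrobenius)
    (h₂ : T₂.IsFrobenius) (t₁ t₂ : A) :
    star (Extension.ι (T₁.braided T₂ e) (star t₁) *
        (Extension.ι _ (T₁.θ (star T₂.w)) * Extension.v _)) *
      (Extension.ι (T₁.braided T₂ e) (star t₂) *
        (Extension.ι _ (star T₁.w) * Extension.v _)) =
    Extension.mk _ (star T₁.w * star T₁.x * T₁.θ (t₁ * star t₂)) := by
  have hU := he.braided_isUnital h₁ h₂
  simp only [Extension.v, Extension.ι_mul_mk hU, mul_one, Extension.star_mk,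
    Extension.mk_mul_mk]
  congr 1
  have hmem : star e * T₂.θ (T₁.θ T₂.w) = T₁.θ (T₂.θ T₂.w) * star e :=
    Intertwiners.star_mem he.mem T₂.w
  have hx2 : star T₂.x * T₂.θ T₂.w = 1 := h₂.star_x_mul_map_w
  -- The braidings disappear because a unit leg can be slid through each of them: `w₁` clears the
  -- `e` in `x`, and `w₂` clears the `e*` in `x*`. The unit laws then absorb both `x₂` and `x₂*`.
  calc star (T₁.θ T₂.w * T₁.w) * star (T₁.θ e * T₁.x * T₁.θ T₂.x) *
        T₁.θ (T₂.θ (star (star t₁ * T₁.θ (star T₂.w)))) *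
        T₁.θ (T₂.θ (star t₂ * star T₁.w)) * (T₁.braided T₂ e).x
      = star T₁.w * T₁.θ (star T₂.w) * T₁.θ (star T₂.x) * star T₁.x *
          T₁.θ (star e * T₂.θ (T₁.θ T₂.w)) * T₁.θ (T₂.θ (t₁ * star t₂)) *
          (T₁.θ (T₂.θ (star T₁.w)) * (T₁.braided T₂ e).x) := by
        simp only [star_mul, map_mul, map_star, star_star, mul_assoc]
    _ = star T₁.w * T₁.θ (star T₂.w) * T₁.θ (star T₂.x) *
          (star T₁.x * T₁.θ (T₁.θ (T₂.θ T₂.w))) * T₁.θ (star e) * T₁.θ (T₂.θ (t₁ * star t₂)) *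
          T₁.θ T₂.x := by
        rw [hmem, he.map_w₁_mul_x h₁]; simp only [map_mul, mul_assoc]
    _ = star T₁.w * T₁.θ (star T₂.w) * T₁.θ (star T₂.x * T₂.θ T₂.w) * star T₁.x * T₁.θ (star e) *
          T₁.θ (T₂.θ (t₁ * star t₂)) * T₁.θ T₂.x := by
        rw [h₁.star_x_mul]; simp only [map_mul, mul_assoc]
    _ = star T₁.w * (T₁.θ (star T₂.w) * star T₁.x) * T₁.θ (star e) *
          T₁.θ (T₂.θ (t₁ * star t₂)) * T₁.θ T₂.x := by
        rw [hx2, map_one, mul_one]; simp only [mul_assoc]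
    _ = star T₁.w * star T₁.x * T₁.θ (T₁.θ (star T₂.w) * star e * T₂.θ (t₁ * star t₂) * T₂.x) := by
        rw [← h₁.star_x_mul]; simp only [map_mul, mul_assoc]
    _ = star T₁.w * star T₁.x * T₁.θ (t₁ * star t₂) := by
        rw [he.star_w₂_mul_star, h₂.star_w_mul, mul_assoc _ _ T₂.x, h₂.unit_left, mul_one]

/-- An intertwiner `a : θ₁ θ₂ → id` which is compatible with half-braidings `e₁₁`, `e₂₁` of `θ₁`,
`θ₂` with `θ₁`, and with half-braidings `e`, `e₂₂` of `θ₁`, `θ₂` with `θ₂`, satisfies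
`a x = θ(a) x` in the braided product. -/
theorem IsFrobenius.mul_braided_x (h₁ : T₁.IsFrobenius) {a e₁₁ e₂₂ : A}
    (he : star e * e = 1)
    (h1 : T₁.θ a * (e₁₁ * T₁.θ (star e)) = a) (h2 : T₂.θ a * (e * T₁.θ e₂₂) = a)
    (hu : star e₁₁ * e₁₁ = 1) (hu' : e₁₁ * star e₁₁ = 1) (hx₁ : e₁₁ * T₁.x = T₁.x) (hx₂ : e₂₂ * T₂.x = T₂.x) :
    a * (T₁.braided T₂ e).x = (T₁.braided T₂ e).θ a * (T₁.braided T₂ e).x := by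
  have hx₁' : star e₁₁ * T₁.x = T₁.x := by
    conv_lhs => rw [← hx₁]
    rw [← mul_assoc, hu, one_mul]
  have hcomm : e₁₁ * T₁.θ (star e) * (T₁.θ e * star e₁₁) = 1 := by
    rw [mul_assoc, ← mul_assoc (T₁.θ (star e)), ← map_mul, he, map_one, one_mul, hu']
  -- Moving `a` past `θ₁` cancels `e` and leaves `e₁₁*`, which is absorbed by `x₁`.
  have k1 : a * T₁.θ e * T₁.x = T₁.θ a * T₁.x := by
    calc a * T₁.θ e * T₁.x = a * (T₁.θ e * star e₁₁) * T₁.x := by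
          rw [← mul_assoc a, mul_assoc _ (star e₁₁) T₁.x, hx₁']
      _ = T₁.θ a * (e₁₁ * T₁.θ (star e) * (T₁.θ e * star e₁₁)) * T₁.x := by
          conv_lhs => rw [← h1]
          simp only [mul_assoc]
      _ = T₁.θ a * T₁.x := by rw [hcomm, mul_one]
  -- Moving `a` past `θ₂` produces `e₂₂`, which is absorbed by `x₂`.
  have k2 : a * T₁.θ T₂.x = T₂.θ a * e * T₁.θ T₂.x := by
    conv_lhs => rw [← h2]
    simp only [mul_assoc, ← map_mul, hx₂]
  calc a * (T₁.braided T₂ e).x = (a * T₁.θ e * T₁.x) * T₁.θ T₂.x := by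
        simp only [braided, mul_assoc]
    _ = T₁.θ a * (T₁.x * T₁.θ T₂.x) := by rw [k1, mul_assoc]
    _ = T₁.θ (a * T₁.θ T₂.x) * T₁.x := by
        rw [h₁.x_mem, map_mul]; simp only [mul_assoc]; rfl
    _ = T₁.θ (T₂.θ a * e) * (T₁.θ (T₁.θ T₂.x) * T₁.x) := by
        rw [k2]; simp only [map_mul, mul_assoc]
    _ = T₁.θ (T₂.θ a * e) * (T₁.x * T₁.θ T₂.x) := by rw [h₁.x_mem T₂.x]; rfl
    _ = (T₁.braided T₂ e).θ a * (T₁.braided T₂ e).x := by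
        simp only [braided, map_mul, mul_assoc, StarAlgHom.comp_apply]

end AlgTriple

end Algebraic

/-! ## Geometry of the localization regions -/

namespace Region

variable {S : Spacetime}

theorem Sub.refl (O : Region S) : O.Sub O := by
  cases S <;> simp [Sub, OpenInterval.Sub]

theorem LeftOf.mono {O O' P P' : Region S} (h : O.LeftOf P) (hO : O'.Sub O) (hP : P'.Sub P) :
    O'.LeftOf P' := by
  cases S <;> simp only [LeftOf, Sub, OpenInterval.Sub, OpenInterval.Before] at *
  · exact (hO.2.trans h).trans hP.1
  · exact ⟨(hO.1.2.trans h.1).trans hP.1.1, (hP.2.2.trans h.2).trans hO.2.1⟩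

theorem Separated.mono {O O' P P' : Region S} (h : O.Separated P) (hO : O'.Sub O)
    (hP : P'.Sub P) : O'.Separated P' :=
  h.imp (fun h => h.mono hO hP) (fun h => h.mono hP hO)

theorem Separated.symm {O P : Region S} (h : O.Separated P) : P.Separated O := Or.symm h

/-- Every region lies between two others. -/
theorem exists_leftOf_leftOf (O : Region S) :
    ∃ L R : Region S, L.LeftOf O ∧ O.LeftOf R ∧ L.LeftOf R := by
  have key (I : OpenInterval) : ∃ J K : OpenInterval, J.Before I ∧ I.Before K ∧ J.Before K :=
    ⟨⟨I.left - 1, I.left, by linarith⟩, ⟨I.right, I.right + 1, by linarith⟩, le_rfl, le_rfl,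
      I.left_lt_right.le⟩
  cases S
  · exact key O
  · obtain ⟨J, K, h⟩ := key O.1
    obtain ⟨J', K', h'⟩ := key O.2
    exact ⟨(J, K'), (K, J'), ⟨h.1, h'.2.1⟩, ⟨h.2.1, h'.1⟩, ⟨h.2.2, h'.2.2⟩⟩

/-- Two ordered pairs of regions are connected by moving one of the regions at a time, within a
region which remains to the left (right) of the other. -/
theorem exists_chain {O P O' P' : Region S} (h : P.LeftOf O) (h' : P'.LeftOf O') :
    ∃ P₀ A B C : Region S, (P.Sub A ∧ P₀.Sub A ∧ A.LeftOf O) ∧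
      (O.Sub B ∧ O'.Sub B ∧ P₀.LeftOf B) ∧ (P₀.Sub C ∧ P'.Sub C ∧ C.LeftOf O') := by
  have key {I J I' J' : OpenInterval} (h : J.Before I) (h' : J'.Before I') :
      ∃ J₀ A B C : OpenInterval, (J.Sub A ∧ J₀.Sub A ∧ A.Before I) ∧
        (I.Sub B ∧ I'.Sub B ∧ J₀.Before B) ∧ (J₀.Sub C ∧ J'.Sub C ∧ C.Before I') := by
    have := I.left_lt_right
    have := J.left_lt_right
    have := I'.left_lt_right
    have := J'.left_lt_right
    simp only [OpenInterval.Before, OpenInterval.Sub] at *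
    -- `J₀` is placed to the left of both `J` and `J'`. The hulls of `J₀` with `J` and with `J'`
    -- then keep their right ends, while the other interval can move freely to the right of `m`.
    set m := min J.left J'.left with hm
    have m1 : m ≤ J.left := min_le_left _ _
    have m2 : m ≤ J'.left := min_le_right _ _
    refine ⟨⟨m - 1, m, by linarith⟩, ⟨m - 1, J.right, by linarith⟩,
      ⟨m, max I.right I'.right, by linarith [le_max_left I.right I'.right]⟩,
      ⟨m - 1, J'.right, by linarith⟩, ?_, ?_, ?_⟩ <;>
    refine ⟨⟨?_, ?_⟩, ⟨?_, ?_⟩, ?_⟩ <;>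
    first | exact le_max_left _ _ | exact le_max_right _ _ | (simp only; linarith)
  -- The mirror image of `key`, needed because the order is reversed in the second light-cone
  -- coordinate.
  have key' {I J I' J' : OpenInterval} (h : I.Before J) (h' : I'.Before J') :
      ∃ J₀ A B C : OpenInterval, (J.Sub A ∧ J₀.Sub A ∧ I.Before A) ∧
        (I.Sub B ∧ I'.Sub B ∧ B.Before J₀) ∧ (J₀.Sub C ∧ J'.Sub C ∧ I'.Before C) := by
    have := I.left_lt_right
    have := J.left_lt_right
    have := I'.left_lt_right
    have := J'.left_lt_right
    simp only [OpenInterval.Before, OpenInterval.Sub] at *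
    set m := max J.right J'.right with hm
    have m1 : J.right ≤ m := le_max_left _ _
    have m2 : J'.right ≤ m := le_max_right _ _
    refine ⟨⟨m, m + 1, by linarith⟩, ⟨J.left, m + 1, by linarith⟩,
      ⟨min I.left I'.left, m, by linarith [min_le_left I.left I'.left]⟩,
      ⟨J'.left, m + 1, by linarith⟩, ?_, ?_, ?_⟩ <;>
    refine ⟨⟨?_, ?_⟩, ⟨?_, ?_⟩, ?_⟩ <;>
    first | exact min_le_left _ _ | exact min_le_right _ _ | (simp only; linarith)
  cases S
  · exact key h h'
  · obtain ⟨P₀, A, B, C, h1, h2, h3⟩ := key h.1 h'.1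
    obtain ⟨Q₀, D, E, F, k1, k2, k3⟩ := key' h.2 h'.2
    exact ⟨(P₀, Q₀), (A, D), (B, E), (C, F), ⟨⟨h1.1, k1.1⟩, ⟨h1.2.1, k1.2.1⟩, h1.2.2, k1.2.2⟩,
      ⟨⟨h2.1, k2.1⟩, ⟨h2.2.1, k2.2.1⟩, h2.2.2, k2.2.2⟩,
      ⟨h3.1, k3.1⟩, ⟨h3.2.1, k3.2.1⟩, h3.2.2, k3.2.2⟩

end Region

/-! ## Local observables and charge transporters -/

section Net

variable {S : Spacetime}
  {H : Type*} [NormedAddCommGroup H] [InnerProductSpace ℂ H] [CompleteSpace H]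

namespace LocalNet

variable (𝔄 : LocalNet H S)

instance isClosed_quasiLocal : IsClosed (𝔄.quasiLocal : Set (H →L[ℂ] H)) :=
  StarSubalgebra.isClosed_topologicalClosure _

noncomputable instance : CStarAlgebra 𝔄.Obs := StarSubalgebra.cstarAlgebra 𝔄.quasiLocal

variable {𝔄}

theorem mem_quasiLocal {O : Region S} {a : H →L[ℂ] H} (ha : a ∈ 𝔄.alg O) : a ∈ 𝔄.quasiLocal :=
  StarSubalgebra.le_topologicalClosure _
    ((le_iSup (fun O : Region S => (𝔄.alg O).toStarSubalgebra) O) ha)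

theorem IsLocalObs.of_commute {O : Region S} {c : 𝔄.Obs}
    (h : ∀ P : Region S, P.Separated O → ∀ a : 𝔄.Obs, 𝔄.IsLocalObs P a → c * a = a * c) :
    𝔄.IsLocalObs O c := by
  refine 𝔄.haag_duality O _ fun P hP b hb => ?_
  exact congrArg Subtype.val (h P hP ⟨b, mem_quasiLocal hb⟩ hb)

theorem IsLocalObs.commute {O P : Region S} {a b : 𝔄.Obs} (ha : 𝔄.IsLocalObs O a)
    (hb : 𝔄.IsLocalObs P b) (h : O.Separated P) : a * b = b * a :=
  Subtype.ext (𝔄.locality O P h _ ha _ hb)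

theorem norm_starAlgHom_le (f : 𝔄.Obs →⋆ₐ[ℂ] 𝔄.Obs) (a : 𝔄.Obs) : ‖f a‖ ≤ ‖a‖ :=
  NonUnitalStarAlgHom.norm_apply_le (A := 𝔄.Obs) (B := 𝔄.Obs) f a

theorem continuous_starAlgHom (f : 𝔄.Obs →⋆ₐ[ℂ] 𝔄.Obs) : Continuous f :=
  AddMonoidHomClass.continuous_of_bound f 1 fun a => by
    rw [one_mul]; exact norm_starAlgHom_le f a

/-- Star homomorphisms which agree on the local observables are equal. -/
theorem starAlgHom_ext {f g : 𝔄.Obs →⋆ₐ[ℂ] 𝔄.Obs}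
    (h : ∀ O : Region S, ∀ a : 𝔄.Obs, 𝔄.IsLocalObs O a → f a = g a) : f = g := by
  have hle : (⨆ O : Region S, (𝔄.alg O).toStarSubalgebra) ≤
      (StarAlgHom.equalizer f g).map 𝔄.quasiLocal.subtype :=
    iSup_le fun O a ha => ⟨⟨a, mem_quasiLocal ha⟩, h O _ ha, rfl⟩
  refine StarAlgHom.ext_topologicalClosure (continuous_starAlgHom f) (continuous_starAlgHom g)
    (StarAlgHom.ext fun a => ?_)
  obtain ⟨b, hb, hba⟩ := hle a.2
  have : StarSubalgebra.inclusion (StarSubalgebra.le_topologicalClosure _) a = b :=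
    Subtype.ext hba.symm
  exact (congrArg f this).trans (hb.trans (congrArg g this).symm)

/-- Observables which commute with all observables are scalars. -/
theorem exists_smul_one_of_central {z : 𝔄.Obs} (h : ∀ a, z * a = a * z) :
    ∃ c : ℂ, z = c • (1 : 𝔄.Obs) := by
  -- By Haag duality a central observable lies in each local algebra, hence in the centre of a
  -- factor.
  obtain ⟨c, hc⟩ := (𝔄.typeIII (Region.refLeft S)).factor z
    (IsLocalObs.of_commute fun _ _ a _ => h a)
    (fun a ha => (congrArg Subtype.val (h ⟨a, mem_quasiLocal ha⟩)).symm)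
  exact ⟨c, Subtype.ext hc⟩

theorem nontrivial (𝔄 : LocalNet H S) : Nontrivial H := by
  by_contra hH
  rw [not_nontrivial_iff_subsingleton] at hH
  obtain ⟨a, -, ha⟩ := (𝔄.typeIII (Region.refLeft S)).not_scalar
  exact ha 0 (ContinuousLinearMap.ext fun x => Subsingleton.elim _ _)

/-! ### Charge transporters and exchange operators. -/

namespace Transports

variable {ρ σ : 𝔄.Obs →⋆ₐ[ℂ] 𝔄.Obs} {O P : Region S} {u v : 𝔄.Obs}

theorem star_mul_self (h : 𝔄.Transports ρ O u) : star u * u = 1 := (Unitary.mem_iff.1 h.1).1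

theorem mul_star_self (h : 𝔄.Transports ρ O u) : u * star u = 1 := (Unitary.mem_iff.1 h.1).2

theorem mul_map (h : 𝔄.Transports ρ O u) (hP : P.Separated O) {a : 𝔄.Obs}
    (ha : 𝔄.IsLocalObs P a) : u * ρ a = a * u := by
  conv_rhs => rw [← h.2 P hP a ha]
  rw [mul_assoc, h.star_mul_self, mul_one]

theorem map_mul_star (h : 𝔄.Transports ρ O u) (hP : P.Separated O) {a : 𝔄.Obs}
    (ha : 𝔄.IsLocalObs P a) : ρ a * star u = star u * a := by
  conv_rhs => rw [← h.2 P hP a ha]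
  rw [← mul_assoc, ← mul_assoc, h.star_mul_self, one_mul]

theorem mono (h : 𝔄.Transports ρ O u) (hO : O.Sub P) : 𝔄.Transports ρ P u :=
  ⟨h.1, fun Q hQ a ha => h.2 Q (hQ.mono (Region.Sub.refl Q) hO) a ha⟩

theorem id (𝔄 : LocalNet H S) (O : Region S) : 𝔄.Transports (StarAlgHom.id ℂ 𝔄.Obs) O 1 :=
  ⟨one_mem _, fun _ _ a _ => by simp⟩

theorem comp (hu : 𝔄.Transports ρ O u) (hv : 𝔄.Transports σ O v) :
    𝔄.Transports (ρ.comp σ) O (u * ρ v) := by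
  refine ⟨mul_mem hu.1 (Unitary.map_mem ρ hv.1), fun P hP a ha => ?_⟩
  rw [StarAlgHom.comp_apply, star_mul, ← map_star]
  calc u * ρ v * ρ (σ a) * (ρ (star v) * star u) = u * ρ (v * σ a * star v) * star u := by
        simp only [map_mul, mul_assoc]
    _ = a := by rw [hv.2 P hP a ha, hu.2 P hP a ha]

/-- Haag duality: intertwiners between endomorphisms localized in `O` are localized in `O`. -/
theorem isLocalObs (hu : 𝔄.Transports ρ O u) (hv : 𝔄.Transports σ O v) {t : 𝔄.Obs}
    (ht : t ∈ Intertwiners ρ σ) : 𝔄.IsLocalObs O (v * t * star u) := by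
  refine IsLocalObs.of_commute fun P hP a ha => ?_
  rw [mul_assoc, ← hu.map_mul_star hP ha, ← mul_assoc, mul_assoc v, ht a, ← mul_assoc,
    hv.mul_map hP ha]
  simp only [mul_assoc]

end Transports

/-- The operator `σ(u*) v* u ρ(v) : ρ σ → σ ρ` formed with unitaries `u` and `v`. -/
noncomputable def exchange (ρ σ : 𝔄.Obs →⋆ₐ[ℂ] 𝔄.Obs) (u v : 𝔄.Obs) : 𝔄.Obs := σ (star u) * star v * u * ρ v

variable {ρ σ : 𝔄.Obs →⋆ₐ[ℂ] 𝔄.Obs} {O P O' P' : Region S} {u v u' v' : 𝔄.Obs}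

theorem star_exchange (ρ σ : 𝔄.Obs →⋆ₐ[ℂ] 𝔄.Obs) (u v : 𝔄.Obs) :
    star (exchange ρ σ u v) = exchange σ ρ v u := by
  simp only [exchange, star_mul, star_star, ← map_star, mul_assoc]

theorem exchange_mem_unitary (hu : u ∈ unitary 𝔄.Obs) (hv : v ∈ unitary 𝔄.Obs) :
    exchange ρ σ u v ∈ unitary 𝔄.Obs :=
  mul_mem (mul_mem (mul_mem (Unitary.map_mem σ (Unitary.star_mem hu)) (Unitary.star_mem hv)) hu)
    (Unitary.map_mem ρ hv)

/-- Two transporters of `σ` into `P` differ by `v' v*`, which lies in `𝔄(P)` by Haag duality. Since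
`P` is separated from `O`, it passes through `u ρ(·)` and cancels. -/
theorem exchange_congr_right (hu : 𝔄.Transports ρ O u) (hv : 𝔄.Transports σ P v)
    (hv' : 𝔄.Transports σ P v') (h : P.Separated O) :
    exchange ρ σ u v = exchange ρ σ u v' := by
  have hz : 𝔄.IsLocalObs P (v' * star v) := by
    simpa using hv.isLocalObs hv' (t := 1) (fun a => by simp)
  have h1 := hu.mul_map h hz
  have e1 : v' = v' * star v * v := by rw [mul_assoc, hv.star_mul_self, mul_one]
  have e2 : star v' * (v' * star v) = star v := by
    rw [← mul_assoc, hv'.star_mul_self, one_mul]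
  calc exchange ρ σ u v = σ (star u) * (star v' * (v' * star v)) * u * ρ v := by
        rw [e2, exchange]
    _ = σ (star u) * star v' * (u * ρ (v' * star v)) * ρ v := by
        rw [h1]; simp only [mul_assoc]
    _ = exchange ρ σ u v' := by
        conv_rhs => rw [exchange, e1, map_mul ρ, ← e1]
        simp only [mul_assoc]

theorem exchange_congr_left (hu : 𝔄.Transports ρ O u) (hu' : 𝔄.Transports ρ O u')
    (hv : 𝔄.Transports σ P v) (h : P.Separated O) :
    exchange ρ σ u v = exchange ρ σ u' v := by
  rw [← star_exchange, ← star_exchange σ ρ v u', exchange_congr_right hv hu hu' h.symm]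

end LocalNet

namespace DHREndo

open LocalNet

variable {𝔄 : LocalNet H S}

/-- Along the chain only one transporter changes at a time, inside a region that stays separated
from the other charge; the detour through `P₀` preserves the causal order. -/
theorem exchange_eq_of_leftOf {ρ σ : DHREndo 𝔄} {O P O' P' : Region S} {u v u' v' : 𝔄.Obs}
    (hu : 𝔄.Transports ρ.toHom O u) (hv : 𝔄.Transports σ.toHom P v) (h : P.LeftOf O)
    (hu' : 𝔄.Transports ρ.toHom O' u') (hv' : 𝔄.Transports σ.toHom P' v') (h' : P'.LeftOf O') :
    exchange ρ.toHom σ.toHom u v = exchange ρ.toHom σ.toHom u' v' := by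
  obtain ⟨P₀, A, B, C, ⟨hA1, hA2, hA3⟩, ⟨hB1, hB2, hB3⟩, hC1, hC2, hC3⟩ :=
    Region.exists_chain h h'
  obtain ⟨v₀, hv₀⟩ := σ.transportable P₀
  rw [exchange_congr_right hu (hv.mono hA1) (hv₀.mono hA2) (Or.inl hA3),
    exchange_congr_left (hu.mono hB1) (hu'.mono hB2) hv₀ (Or.inl hB3),
    exchange_congr_right hu' (hv₀.mono hC1) (hv'.mono hC2) (Or.inl hC3)]

/-- The braiding may be computed from any charge transporters into ordered regions. -/
theorem braiding_eq {ρ σ : DHREndo 𝔄} {O P : Region S} {u v : 𝔄.Obs}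
    (hu : 𝔄.Transports ρ.toHom O u) (hv : 𝔄.Transports σ.toHom P v) (h : P.LeftOf O) :
    ρ.braiding σ = exchange ρ.toHom σ.toHom u v :=
  exchange_eq_of_leftOf (Classical.choose_spec (ρ.transportable _))
    (Classical.choose_spec (σ.transportable _)) (Region.refLeft_leftOf_refRight S) hu hv h

end DHREndo

/-- The causal order of the regions into which the charges are transported in the definition of
the braiding with the given sign. -/
def BraidSign.Ordered : BraidSign → Region S → Region S → Prop
  | .plus, O, P => P.LeftOf O
  | .minus, O, P => O.LeftOf P

theorem BraidSign.Ordered.separated {s : BraidSign} {O P : Region S} (h : s.Ordered O P) :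
    P.Separated O := by
  cases s
  · exact Or.inl h
  · exact Or.inr h

theorem BraidSign.exists_ordered (s : BraidSign) (Q : Region S) :
    ∃ O P : Region S, s.Ordered O P ∧ Q.Separated O ∧ Q.Separated P := by
  obtain ⟨L, R, hL, hR, h⟩ := Region.exists_leftOf_leftOf Q
  cases s
  · exact ⟨R, L, h, Or.inl hR, Or.inr hL⟩
  · exact ⟨L, R, h, Or.inr hL, Or.inl hR⟩

/-- The opposite sign. -/
def BraidSign.opp : BraidSign → BraidSign
  | .plus => .minus
  | .minus => .plus

/-! ### The braiding as a natural unitary intertwiner. -/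

section Braiding

open LocalNet

variable {𝔄 : LocalNet H S} (s : BraidSign) (ρ σ τ : DHREndo 𝔄)

variable {s ρ σ} in
theorem signedBraiding_eq {O P : Region S} {u v : 𝔄.Obs} (hu : 𝔄.Transports ρ.toHom O u)
    (hv : 𝔄.Transports σ.toHom P v) (h : s.Ordered O P) :
    signedBraiding s ρ σ = exchange ρ.toHom σ.toHom u v := by
  cases s
  · exact DHREndo.braiding_eq hu hv h
  · exact (congrArg star (DHREndo.braiding_eq hv hu h)).trans (star_exchange _ _ _ _)

theorem star_signedBraiding : star (signedBraiding s ρ σ) = signedBraiding s.opp σ ρ := by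
  cases s
  · rfl
  · exact star_star _

theorem signedBraiding_mem_unitary : signedBraiding s ρ σ ∈ unitary 𝔄.Obs := by
  obtain ⟨O, P, h, -, -⟩ := s.exists_ordered (Region.refLeft S)
  obtain ⟨u, hu⟩ := ρ.transportable O
  obtain ⟨v, hv⟩ := σ.transportable P
  rw [signedBraiding_eq hu hv h]
  exact exchange_mem_unitary hu.1 hv.1

/-- Both charges can be transported away from `Q`, one to each side in the order prescribed by the
sign. The transporters then carry `ρ(a)` and `σ(a)` to `a`. -/
theorem signedBraiding_mul_of_isLocalObs {Q : Region S} {a : 𝔄.Obs} (ha : 𝔄.IsLocalObs Q a) :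
    signedBraiding s ρ σ * ρ.toHom (σ.toHom a) = σ.toHom (ρ.toHom a) * signedBraiding s ρ σ := by
  obtain ⟨O, P, h, hO, hP⟩ := s.exists_ordered Q
  obtain ⟨u, hu⟩ := ρ.transportable O
  obtain ⟨v, hv⟩ := σ.transportable P
  rw [signedBraiding_eq hu hv h]
  calc exchange ρ.toHom σ.toHom u v * ρ.toHom (σ.toHom a)
      = σ.toHom (star u) * star v * u * ρ.toHom (v * σ.toHom a) := by
        simp only [exchange, map_mul, mul_assoc]
    _ = σ.toHom (star u) * star v * (u * ρ.toHom a) * ρ.toHom v := by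
        rw [hv.mul_map hP ha]; simp only [map_mul, mul_assoc]
    _ = σ.toHom (star u) * (star v * a) * u * ρ.toHom v := by
        rw [hu.mul_map hO ha]; simp only [mul_assoc]
    _ = σ.toHom (star u * a) * star v * u * ρ.toHom v := by
        rw [← hv.map_mul_star hP ha]; simp only [map_mul, mul_assoc]
    _ = σ.toHom (ρ.toHom a) * exchange ρ.toHom σ.toHom u v := by
        rw [← hu.map_mul_star hO ha]; simp only [exchange, map_mul, mul_assoc]

theorem signedBraiding_mem :
    signedBraiding s ρ σ ∈
      Intertwiners (ρ.toHom.comp σ.toHom) (σ.toHom.comp ρ.toHom) := by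
  set e : unitary 𝔄.Obs := ⟨_, signedBraiding_mem_unitary s ρ σ⟩ with he
  have hee : star (e : 𝔄.Obs) * e = 1 := (Unitary.mem_iff.1 e.2).1
  have hee' : (e : 𝔄.Obs) * star (e : 𝔄.Obs) = 1 := (Unitary.mem_iff.1 e.2).2
  -- Written as an equality of *-homomorphisms, which are automatically continuous, the relation
  -- extends from local observables to the norm closure.
  have key : ((Unitary.conjStarAlgAut ℂ 𝔄.Obs e : 𝔄.Obs ≃⋆ₐ[ℂ] 𝔄.Obs) :
      𝔄.Obs →⋆ₐ[ℂ] 𝔄.Obs).comp (ρ.toHom.comp σ.toHom) = σ.toHom.comp ρ.toHom := by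
    refine starAlgHom_ext fun Q a ha => ?_
    have := signedBraiding_mul_of_isLocalObs s ρ σ ha
    change (e : 𝔄.Obs) * _ = _ at this
    simp only [StarAlgHom.comp_apply]
    change (e : 𝔄.Obs) * _ * star (e : 𝔄.Obs) = _
    rw [this, mul_assoc]
    change _ * ((e : 𝔄.Obs) * star (e : 𝔄.Obs)) = _
    rw [hee', mul_one]
  intro a
  have := DFunLike.congr_fun key a
  change (e : 𝔄.Obs) * _ * star (e : 𝔄.Obs) = _ at this
  change (e : 𝔄.Obs) * _ = _ * (e : 𝔄.Obs)
  rw [← this, mul_assoc, mul_assoc, hee, mul_one]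
  rfl

/-- The braiding is natural with respect to intertwiners `id → σ`. -/
theorem signedBraiding_mul_map {w : 𝔄.Obs}
    (hw : w ∈ Intertwiners (StarAlgHom.id ℂ 𝔄.Obs) σ.toHom) :
    signedBraiding s ρ σ * ρ.toHom w = w := by
  obtain ⟨O, P, h, -, -⟩ := s.exists_ordered (Region.refLeft S)
  obtain ⟨u, hu⟩ := ρ.transportable O
  obtain ⟨v, hv⟩ := σ.transportable P
  rw [signedBraiding_eq hu hv h]
  -- An intertwiner from `id` to the transported `σ` lies in `𝔄(P)`, so the transported `ρ` acts
  -- trivially on it.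
  have hl : 𝔄.IsLocalObs P (v * w) := by
    simpa using (Transports.id 𝔄 P).isLocalObs hv hw
  have h1 : w * star u = σ.toHom (star u) * w := hw (star u)
  calc exchange ρ.toHom σ.toHom u v * ρ.toHom w
      = σ.toHom (star u) * star v * (u * ρ.toHom (v * w)) := by
        simp only [exchange, map_mul, mul_assoc]
    _ = (σ.toHom (star u) * ((star v * v) * w)) * u := by
        rw [hu.mul_map h.separated hl]; simp only [mul_assoc]
    _ = w := by
        rw [hv.star_mul_self, one_mul, ← h1, mul_assoc, hu.star_mul_self, mul_one]

/-- The braiding is natural with respect to intertwiners `id → ρ`. -/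
theorem signedBraiding_mul {w : 𝔄.Obs}
    (hw : w ∈ Intertwiners (StarAlgHom.id ℂ 𝔄.Obs) ρ.toHom) :
    signedBraiding s ρ σ * w = σ.toHom w := by
  have h := signedBraiding_mul_map s.opp σ ρ hw
  rw [← star_signedBraiding] at h
  conv_lhs => rw [← h]
  rw [← mul_assoc, (Unitary.mem_iff.1 (signedBraiding_mem_unitary s ρ σ)).2, one_mul]

/-- The braiding is natural with respect to intertwiners `ρ σ → id`. -/
theorem map_mul_signedBraiding_mul {a : 𝔄.Obs}
    (ha : a ∈ Intertwiners (ρ.toHom.comp σ.toHom) (StarAlgHom.id ℂ 𝔄.Obs)) :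
    τ.toHom a * (signedBraiding s ρ τ * ρ.toHom (signedBraiding s σ τ)) = a := by
  obtain ⟨O, P, h, -, -⟩ := s.exists_ordered (Region.refLeft S)
  obtain ⟨u, hu⟩ := ρ.transportable O
  -- Both `ρ` and `σ` are carried into the same `O`, so that `u ρ(v)` carries `ρσ` there and `a (u
  -- ρ(v))*` is local in `O`.
  obtain ⟨v, hv⟩ := σ.transportable O
  obtain ⟨z, hz⟩ := τ.transportable P
  have hmem := signedBraiding_mem s ρ τ (star v)
  simp only [StarAlgHom.comp_apply] at hmem
  have hl : 𝔄.IsLocalObs O (a * star (u * ρ.toHom v)) := by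
    simpa using (hu.comp hv).isLocalObs (Transports.id 𝔄 O) ha
  have h1 := hz.map_mul_star h.separated.symm hl
  have h2 : a * ρ.toHom (σ.toHom z) = z * a := ha z
  have h3 : u * ρ.toHom v ∈ unitary 𝔄.Obs := (hu.comp hv).1
  calc τ.toHom a * (signedBraiding s ρ τ * ρ.toHom (signedBraiding s σ τ))
      = τ.toHom a * (signedBraiding s ρ τ * ρ.toHom (τ.toHom (star v))) *
          ρ.toHom (star z * v * σ.toHom z) := by
        rw [signedBraiding_eq (s := s) hv hz h]
        simp only [exchange, map_mul, mul_assoc]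
    _ = τ.toHom a * τ.toHom (ρ.toHom (star v)) * τ.toHom (star u) * star z * u *
          ρ.toHom ((z * star z) * v * σ.toHom z) := by
        rw [hmem, signedBraiding_eq (s := s) hu hz h]
        simp only [exchange, map_mul, mul_assoc]
    _ = τ.toHom (a * star (u * ρ.toHom v)) * star z * (u * ρ.toHom v) * ρ.toHom (σ.toHom z) := by
        rw [hz.mul_star_self, one_mul]
        simp only [star_mul, map_mul, mul_assoc, map_star]
    _ = star z * (a * (star (u * ρ.toHom v) * (u * ρ.toHom v)) * ρ.toHom (σ.toHom z)) := by
        rw [h1]; simp only [mul_assoc]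
    _ = a := by
        rw [(Unitary.mem_iff.1 h3).1, mul_one, h2, ← mul_assoc, hz.star_mul_self, one_mul]

end Braiding

end Net

/-! ## Decomposition of DHR endomorphisms into irreducibles -/

section Net

variable {S : Spacetime}
  {H : Type*} [NormedAddCommGroup H] [InnerProductSpace ℂ H] [CompleteSpace H]

open LocalNet

variable {𝔄 : LocalNet H S}

/-- Nonzero local projections are range projections of local isometries. -/
theorem LocalNet.exists_local_isometry {O : Region S} {e : 𝔄.Obs} (he : 𝔄.IsLocalObs O e)
    (hp : IsStarProjection e) (h0 : e ≠ 0) :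
    ∃ s : 𝔄.Obs, 𝔄.IsLocalObs O s ∧ s * star s = e ∧ star s * s = 1 := by
  have hp' : IsStarProjection (e : H →L[ℂ] H) :=
    ⟨congrArg Subtype.val hp.isIdempotentElem, congrArg Subtype.val hp.isSelfAdjoint⟩
  obtain ⟨s, hs, h1, h2⟩ := (𝔄.typeIII O).equiv_one e he hp' fun h => h0 (Subtype.ext h)
  exact ⟨⟨s, mem_quasiLocal hs⟩, hs, Subtype.ext h1, Subtype.ext h2⟩

/-- The compression `a ↦ s* ρ(a) s` by an isometry with range projection in the commutant. -/
noncomputable def compression (ρ : 𝔄.Obs →⋆ₐ[ℂ] 𝔄.Obs) (s : 𝔄.Obs) (hs : star s * s = 1)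
    (hρ : s * star s ∈ Intertwiners ρ ρ) : 𝔄.Obs →⋆ₐ[ℂ] 𝔄.Obs where
  toFun a := star s * ρ a * s
  map_one' := by rw [map_one, mul_one, hs]
  map_mul' a b := by
    calc star s * ρ (a * b) * s = (star s * s) * star s * ρ a * ρ b * s := by
          rw [hs, one_mul, map_mul, ← mul_assoc]
      _ = star s * (s * star s * ρ a) * ρ b * s := by simp only [mul_assoc]
      _ = star s * ρ a * s * (star s * ρ b * s) := by rw [hρ a]; simp only [mul_assoc]
  map_zero' := by rw [map_zero, mul_zero, zero_mul]
  map_add' a b := by rw [map_add, mul_add, add_mul]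
  commutes' c := by
    rw [AlgHomClass.commutes, ← Algebra.commutes, mul_assoc, hs, mul_one]
  map_star' a := by rw [map_star, star_mul, star_mul, star_star, mul_assoc]

theorem compression_mem {ρ : 𝔄.Obs →⋆ₐ[ℂ] 𝔄.Obs} {s : 𝔄.Obs} (hs : star s * s = 1)
    (hρ : s * star s ∈ Intertwiners ρ ρ) : s ∈ Intertwiners (compression ρ s hs hρ) ρ := by
  intro a
  change s * (star s * ρ a * s) = ρ a * s
  rw [← mul_assoc, ← mul_assoc, hρ a, mul_assoc, mul_assoc, hs, mul_one]

/-- Projections in the commutant of a DHR endomorphism define subobjects. -/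
theorem DHREndo.exists_sub (ρ : DHREndo 𝔄) {e : 𝔄.Obs} (hp : IsStarProjection e) (h0 : e ≠ 0)
    (he : e ∈ Intertwiners ρ.toHom ρ.toHom) :
    ∃ σ : DHREndo 𝔄, ∃ s ∈ Intertwiners σ.toHom ρ.toHom, star s * s = 1 ∧ s * star s = e := by
  obtain ⟨O, hO⟩ := ρ.localized
  have hl : 𝔄.IsLocalObs O e := by simpa using hO.isLocalObs hO he
  -- Choosing `s` inside `𝔄(O)` makes the compression by `s` localized in `O`.
  obtain ⟨s, hsl, hse, hs⟩ := exists_local_isometry hl hp h0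
  have hρ : s * star s ∈ Intertwiners ρ.toHom ρ.toHom := by rwa [hse]
  refine ⟨⟨compression ρ.toHom s hs hρ, ⟨O, one_mem _, fun P hP a ha => ?_⟩, fun Q => ?_⟩, s,
    compression_mem hs hρ, hs, hse⟩
  · have h1 : ρ.toHom a = a := by simpa using hO.2 P hP a ha
    rw [one_mul, star_one, mul_one]
    change star s * ρ.toHom a * s = a
    rw [h1, mul_assoc, ha.commute hsl hP, ← mul_assoc, hs, one_mul]
  · obtain ⟨u, hu⟩ := ρ.transportable Q
    have hul : 𝔄.IsLocalObs Q (u * e * star u) := hu.isLocalObs hu he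
    have huu := hu.star_mul_self
    have hee : e * e = e := hp.isIdempotentElem
    have hup : IsStarProjection (u * e * star u) := by
      refine ⟨?_, ?_⟩
      · calc u * e * star u * (u * e * star u) = u * (e * (star u * u) * e) * star u := by
              simp only [mul_assoc]
          _ = u * e * star u := by rw [huu, mul_one, hee]
      · change star (u * e * star u) = _
        rw [star_mul, star_mul, star_star, hp.isSelfAdjoint.star_eq, mul_assoc]
    have hu0 : u * e * star u ≠ 0 := by
      intro h
      apply h0
      calc e = star u * u * e * (star u * u) := by rw [huu, one_mul, mul_one]
        _ = star u * (u * e * star u) * u := by simp only [mul_assoc]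
        _ = 0 := by rw [h, mul_zero, zero_mul]
    -- The transported projection also has a local isometry `z`; the subobject is carried into `Q`
    -- by comparing `s` with `z` through `u`.
    obtain ⟨z, hzl, hze, hz⟩ := exists_local_isometry hul hup hu0
    refine ⟨star z * u * s, Unitary.mem_iff.2 ⟨?_, ?_⟩, fun P hP a ha => ?_⟩
    · calc star (star z * u * s) * (star z * u * s)
          = star s * star u * (z * star z) * u * s := by
            simp only [star_mul, star_star, mul_assoc]
        _ = star s * (star u * u) * e * (star u * u) * s := by rw [hze]; simp only [mul_assoc]
        _ = star s * s * (star s * s) := by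
            rw [huu, mul_one, mul_one, ← hse]; simp only [mul_assoc]
        _ = 1 := by rw [hs, one_mul]
    · calc star z * u * s * star (star z * u * s)
          = star z * (u * (s * star s) * star u) * z := by
            simp only [star_mul, star_star, mul_assoc]
        _ = star z * z * (star z * z) := by rw [hse, ← hze]; simp only [mul_assoc]
        _ = 1 := by rw [hz, one_mul]
    · change star z * u * s * (star s * ρ.toHom a * s) * star (star z * u * s) = a
      calc star z * u * s * (star s * ρ.toHom a * s) * star (star z * u * s)
          = star z * u * (s * star s * ρ.toHom a) * (s * star s) * star u * z := by
            simp only [star_mul, star_star, mul_assoc]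
        _ = star z * (u * ρ.toHom a) * (e * e) * star u * z := by
            rw [hρ a, hse]; simp only [mul_assoc]
        _ = star z * (a * (u * e * star u)) * z := by
            rw [hee, hu.mul_map hP ha]; simp only [mul_assoc]
        _ = star z * (a * z) * (star z * z) := by rw [← hze]; simp only [mul_assoc]
        _ = a := by
            rw [ha.commute hzl hP, hz, ← mul_assoc, hz, one_mul, mul_one]

/-! ### Finiteness -/

/-- The intertwiners `id → σ` form a Hilbert space, realized in `H` by evaluation at a unit
vector. -/
theorem star_mul_eq_inner {V W : 𝔄.Obs} {ξ : H} (hξ : ‖ξ‖ = 1)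
    (h : ∀ a, star V * W * a = a * (star V * W)) :
    star V * W = inner ℂ ((V : H →L[ℂ] H) ξ) ((W : H →L[ℂ] H) ξ) • (1 : 𝔄.Obs) := by
  obtain ⟨c, hc⟩ := exists_smul_one_of_central h
  have h1 : ((star V * W : 𝔄.Obs) : H →L[ℂ] H) ξ = c • ξ := by rw [hc]; rfl
  have h2 : inner ℂ ((V : H →L[ℂ] H) ξ) ((W : H →L[ℂ] H) ξ) = c := by
    rw [← ContinuousLinearMap.adjoint_inner_right]
    change inner ℂ ξ (((star V * W : 𝔄.Obs) : H →L[ℂ] H) ξ) = c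
    rw [h1, inner_smul_right, inner_self_eq_norm_sq_to_K, hξ]
    simp
  rw [h2, hc]

theorem star_mul_central {σ : 𝔄.Obs →⋆ₐ[ℂ] 𝔄.Obs} {V W : 𝔄.Obs}
    (hV : V ∈ Intertwiners (StarAlgHom.id ℂ 𝔄.Obs) σ)
    (hW : W ∈ Intertwiners (StarAlgHom.id ℂ 𝔄.Obs) σ) (a : 𝔄.Obs) :
    star V * W * a = a * (star V * W) :=
  Intertwiners.mul_mem (Intertwiners.star_mem hV) hW a

theorem norm_sq_eq_of_star_mul {W : 𝔄.Obs} {c : ℝ} (h0 : 0 ≤ c)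
    (h : star W * W = (c : ℂ) • (1 : 𝔄.Obs)) : ‖W‖ ^ 2 = c := by
  have := 𝔄.nontrivial
  have h1 : ‖(1 : 𝔄.Obs)‖ = 1 := norm_one (α := H →L[ℂ] H)
  rw [sq, ← CStarRing.norm_star_mul_self, h, norm_smul, h1, mul_one, Complex.norm_real,
    Real.norm_of_nonneg h0]

/-- A bound for the length of orthonormal families in the commutant of an endomorphism with
a conjugate. -/
theorem card_le_of_orthonormal {ρ : 𝔄.Obs →⋆ₐ[ℂ] 𝔄.Obs} {r : 𝔄.Obs}
    (hr : r ∈ Intertwiners (StarAlgHom.id ℂ 𝔄.Obs) (ρ.comp ρ)) (hr1 : star r * ρ r = 1)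
    {ξ : H} (hξ : ‖ξ‖ = 1) {n : ℕ} {a : Fin n → 𝔄.Obs} (ha : ∀ i, a i ∈ Intertwiners ρ ρ)
    (ho : Orthonormal ℂ fun i => ((ρ (a i) * r : 𝔄.Obs) : H →L[ℂ] H) ξ) :
    (n : ℝ) ≤ ‖r‖ ^ 8 := by
  have hmem {t : 𝔄.Obs} (ht : t ∈ Intertwiners ρ ρ) :
      ρ t * r ∈ Intertwiners (StarAlgHom.id ℂ 𝔄.Obs) (ρ.comp ρ) :=
    Intertwiners.mul_mem (Intertwiners.map_mem ρ ht) hr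
  -- The conjugacy equation recovers an operator `t` in the commutant from `ρ(t) r`.
  have hrec (t : 𝔄.Obs) : star r * ρ (ρ t * r) = t := by
    have : star r * ρ (ρ t) = t * star r := Intertwiners.star_mem hr t
    rw [map_mul, ← mul_assoc, this, mul_assoc, hr1, mul_one]
  set V : Fin n → 𝔄.Obs := fun i => ρ (a i) * r with hV
  set W : Fin n → 𝔄.Obs := fun i => ρ (star (a i)) * r with hW
  have hVV (i j) : star (V i) * V j = if i = j then 1 else 0 := by
    rw [star_mul_eq_inner hξ (star_mul_central (hmem (ha i)) (hmem (ha j))),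
      orthonormal_iff_ite.1 ho i j]
    split_ifs <;> simp
  -- The `V i` are isometries with orthogonal ranges, so `p` is a projection and `‖p‖ ≤ 1` whatever
  -- `n` is.
  set p : 𝔄.Obs := ∑ i, V i * star (V i) with hp
  have hps : star p = p := by simp [hp, star_sum]
  have hpp : p * p = p := by
    have hVp (i) : V i * star (V i) * p = V i * star (V i) := by
      rw [hp, Finset.mul_sum]
      rw [Finset.sum_eq_single i]
      · rw [mul_assoc, ← mul_assoc (star (V i)), hVV, if_pos rfl, one_mul]
      · intro j _ hj
        rw [mul_assoc, ← mul_assoc (star (V i)), hVV, if_neg hj.symm, zero_mul, mul_zero]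
      · simp
    conv_lhs => rw [hp, Finset.sum_mul]
    rw [← hp, Finset.sum_congr rfl fun i _ => hVp i]
  have hpn : ‖p‖ ≤ 1 := by
    have : ‖p‖ * ‖p‖ = ‖p‖ := by rw [← CStarRing.norm_star_mul_self, hps, hpp]
    nlinarith [norm_nonneg p]
  -- `y` is chosen so that `y* y = ∑ r* ρ(a_i a_i*) r = ∑ W_i* W_i`, while `‖y‖ ≤ ‖r‖²`
  -- independently of `n`. As each `‖W_i‖` is bounded below, `n` is bounded.
  set y : 𝔄.Obs := ρ (ρ p * r) * r with hy
  have hyn : ‖y‖ ≤ ‖r‖ ^ 2 := by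
    calc ‖y‖ ≤ ‖ρ (ρ p * r)‖ * ‖r‖ := norm_mul_le _ _
      _ ≤ (‖ρ p‖ * ‖r‖) * ‖r‖ := by
          gcongr
          exact (norm_starAlgHom_le _ _).trans (norm_mul_le _ _)
      _ ≤ (1 * ‖r‖) * ‖r‖ := by
          gcongr
          exact (norm_starAlgHom_le _ _).trans hpn
      _ = ‖r‖ ^ 2 := by ring
  have hWW (i) : star (W i) * W i =
      ((‖((W i : 𝔄.Obs) : H →L[ℂ] H) ξ‖ ^ 2 : ℝ) : ℂ) • (1 : 𝔄.Obs) := by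
    have hi := hmem (Intertwiners.star_mem (ha i))
    rw [star_mul_eq_inner hξ (star_mul_central hi hi), inner_self_eq_norm_sq_to_K]
    simp only [hW, Complex.ofReal_pow]
    rfl
  have hWn (i) := norm_sq_eq_of_star_mul (sq_nonneg _) (hWW i)
  have hyy : star y * y = ((∑ i, ‖W i‖ ^ 2 : ℝ) : ℂ) • (1 : 𝔄.Obs) := by
    calc star y * y = star r * ρ (star r * ρ (star p * p) * r) * r := by
          simp only [hy, star_mul, map_mul, map_star, mul_assoc]
      _ = ∑ i, star r * ρ ((star r * ρ (V i)) * star (star r * ρ (V i))) * r := by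
          rw [hps, hpp, hp]
          simp only [map_sum, Finset.mul_sum, Finset.sum_mul, map_mul, star_mul, star_star,
            map_star, mul_assoc]
      _ = ∑ i, star (W i) * W i := by
          refine Finset.sum_congr rfl fun i _ => ?_
          rw [hrec]
          simp only [hW, map_mul, star_mul, map_star, star_star, mul_assoc]
      _ = _ := by
          simp only [hWW, ← hWn]
          rw [Complex.ofReal_sum, Finset.sum_smul]
  have hsum := norm_sq_eq_of_star_mul (Finset.sum_nonneg fun i _ => sq_nonneg _) hyy
  have hlow (i) : 1 ≤ ‖r‖ ^ 4 * ‖W i‖ ^ 2 := by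
    have h1 : 1 ≤ ‖V i‖ := by
      have := ho.1 i
      calc 1 = ‖(V i : H →L[ℂ] H) ξ‖ := this.symm
        _ ≤ ‖(V i : H →L[ℂ] H)‖ * ‖ξ‖ := ContinuousLinearMap.le_opNorm _ _
        _ = ‖V i‖ := by rw [hξ, mul_one]; rfl
    have h2 : ‖V i‖ ≤ ‖a i‖ * ‖r‖ := (norm_mul_le _ _).trans (by
      gcongr; exact norm_starAlgHom_le _ _)
    have h3 : ‖a i‖ ≤ ‖r‖ * ‖W i‖ := by
      rw [← norm_star (a i), ← hrec (star (a i))]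
      refine (norm_mul_le _ _).trans ?_
      rw [norm_star]
      gcongr
      exact norm_starAlgHom_le _ _
    have h4 : 1 ≤ ‖r‖ ^ 2 * ‖W i‖ := by
      calc 1 ≤ ‖a i‖ * ‖r‖ := h1.trans h2
        _ ≤ ‖r‖ * ‖W i‖ * ‖r‖ := by gcongr
        _ = _ := by ring
    calc (1 : ℝ) ≤ (‖r‖ ^ 2 * ‖W i‖) ^ 2 := one_le_pow₀ h4
      _ = _ := by ring
  calc (n : ℝ) = ∑ _i : Fin n, (1 : ℝ) := by simp
    _ ≤ ∑ i, ‖r‖ ^ 4 * ‖W i‖ ^ 2 := Finset.sum_le_sum fun i _ => hlow i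
    _ = ‖r‖ ^ 4 * ‖y‖ ^ 2 := by rw [← Finset.mul_sum, hsum]
    _ ≤ ‖r‖ ^ 4 * (‖r‖ ^ 2) ^ 2 := by gcongr
    _ = ‖r‖ ^ 8 := by ring

/-- The commutant of an endomorphism with a conjugate is finite dimensional. -/
theorem finiteDimensional_intertwiners {ρ : 𝔄.Obs →⋆ₐ[ℂ] 𝔄.Obs} {r : 𝔄.Obs}
    (hr : r ∈ Intertwiners (StarAlgHom.id ℂ 𝔄.Obs) (ρ.comp ρ)) (hr1 : star r * ρ r = 1) :
    FiniteDimensional ℂ (intertwinerSubmodule ρ ρ) := by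
  have := 𝔄.nontrivial
  obtain ⟨ξ, hξ⟩ := exists_norm_eq H zero_le_one
  let L : intertwinerSubmodule ρ ρ →ₗ[ℂ] H :=
    { toFun := fun a => ((ρ a * r : 𝔄.Obs) : H →L[ℂ] H) ξ
      map_add' := fun a b => by simp [add_mul]
      map_smul' := fun c a => by simp }
  have hL : Function.Injective L := by
    rw [← LinearMap.ker_eq_bot, LinearMap.ker_eq_bot']
    intro a ha
    have hm : ρ a * r ∈ Intertwiners (StarAlgHom.id ℂ 𝔄.Obs) (ρ.comp ρ) :=
      Intertwiners.mul_mem (Intertwiners.map_mem ρ a.2) hr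
    have h1 := star_mul_eq_inner hξ (star_mul_central hm hm)
    change ((ρ a * r : 𝔄.Obs) : H →L[ℂ] H) ξ = 0 at ha
    rw [ha, inner_zero_left, zero_smul] at h1
    have h2 : ρ a * r = 0 := CStarRing.star_mul_self_eq_zero_iff _ |>.1 h1
    have h3 : star r * ρ (ρ a) = a * star r := Intertwiners.star_mem hr a
    have h4 : (a : 𝔄.Obs) = star r * ρ (ρ a * r) := by
      rw [map_mul, ← mul_assoc, h3, mul_assoc, hr1, mul_one]
    rw [h2, map_zero, mul_zero] at h4
    exact Subtype.ext h4
  obtain ⟨N, hN⟩ := exists_nat_ge (‖r‖ ^ 8)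
  have hrank : Module.rank ℂ (intertwinerSubmodule ρ ρ) ≤ N := by
    -- The span of the images under `L` of a linearly independent family has an orthonormal basis of
    -- the same size; its vectors come from the commutant, so the bound applies.
    refine rank_le fun s hs => ?_
    set f : s → H := fun i => L i with hf
    have hfi : LinearIndependent ℂ f := hs.map' L (LinearMap.ker_eq_bot.2 hL)
    set U := Submodule.span ℂ (Set.range f) with hU
    have hU' : FiniteDimensional ℂ U := FiniteDimensional.span_of_finite ℂ (Set.finite_range f)
    have hcard : Module.finrank ℂ U = s.card := by
      rw [hU, finrank_span_eq_card hfi, Fintype.card_coe]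
    have hUL : U ≤ LinearMap.range L := by
      rw [hU, Submodule.span_le]
      rintro _ ⟨i, rfl⟩
      exact ⟨i, rfl⟩
    let b := stdOrthonormalBasis ℂ U
    choose a ha using fun i => hUL (b i).2
    have ho : Orthonormal ℂ fun i => ((ρ (a i) * r : 𝔄.Obs) : H →L[ℂ] H) ξ := by
      have := b.orthonormal.comp_linearIsometry U.subtypeₗᵢ
      convert this using 2 with i
      exact ha i
    have := card_le_of_orthonormal hr hr1 hξ (fun i => (a i).2) ho
    rw [hcard] at this
    exact_mod_cast this.trans hN
  exact Module.rank_lt_aleph0_iff.1 (hrank.trans_lt Cardinal.natCast_lt_aleph0)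

/-- A reducible endomorphism whose commutant is finite dimensional has a nontrivial projection in
its commutant. -/
theorem exists_projection {ρ : 𝔄.Obs →⋆ₐ[ℂ] 𝔄.Obs}
    [FiniteDimensional ℂ (intertwinerSubmodule ρ ρ)] (hρ : ¬ IsIrreducibleEndo ρ) :
    ∃ e ∈ Intertwiners ρ ρ, IsStarProjection e ∧ e ≠ 0 ∧ e ≠ 1 := by
  obtain ⟨a, ha, hsa, hns⟩ : ∃ a ∈ Intertwiners ρ ρ, IsSelfAdjoint a ∧
      ∀ c : ℂ, a ≠ c • (1 : 𝔄.Obs) := by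
    -- If every self-adjoint element of the commutant were scalar, then so would be every element,
    -- by splitting into real and imaginary parts.
    by_contra! hcon
    refine hρ fun t ht => ?_
    have hre : (realPart t : 𝔄.Obs) ∈ intertwinerSubmodule ρ ρ := by
      rw [realPart_apply_coe]
      exact Submodule.smul_of_tower_mem _ _ (Submodule.add_mem _ ht (Intertwiners.star_mem ht))
    have him : (imaginaryPart t : 𝔄.Obs) ∈ intertwinerSubmodule ρ ρ := by
      rw [imaginaryPart_apply_coe]
      exact Submodule.smul_mem _ _ (Submodule.smul_of_tower_mem _ _
        (Submodule.sub_mem _ ht (Intertwiners.star_mem ht)))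
    obtain ⟨c, hc⟩ := hcon _ hre (realPart t).2
    obtain ⟨d, hd⟩ := hcon _ him (imaginaryPart t).2
    refine ⟨c + Complex.I * d, ?_⟩
    rw [← realPart_add_I_smul_imaginaryPart t, hc, hd, add_smul, mul_smul]
  have hN : IsStarNormal a := hsa.isStarNormal
  have hpow (k : ℕ) : a ^ k ∈ intertwinerSubmodule ρ ρ := by
    induction k with
    | zero => intro b; simp
    | succ k ih => rw [pow_succ]; exact Intertwiners.mul_mem ih ha
  -- All powers of `a` lie in a finite dimensional space, so a nonzero polynomial annihilates `a`
  -- and its roots contain the spectrum.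
  have hfin : (spectrum ℂ a).Finite := by
    obtain ⟨q, hq0, hq⟩ : ∃ q : Polynomial ℂ, q ≠ 0 ∧ Polynomial.aeval a q = 0 := by
      by_contra! hcon
      have hmem (q : Polynomial ℂ) : Polynomial.aeval a q ∈ intertwinerSubmodule ρ ρ := by
        rw [Polynomial.aeval_eq_sum_range]
        exact Submodule.sum_mem _ fun i _ => Submodule.smul_mem _ _ (hpow i)
      let F : Polynomial ℂ →ₗ[ℂ] intertwinerSubmodule ρ ρ :=
        (Polynomial.aeval a).toLinearMap.codRestrict _ hmem
      have hF : Function.Injective F := by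
        rw [← LinearMap.ker_eq_bot, LinearMap.ker_eq_bot']
        intro q hq
        by_contra h
        exact hcon q h (congrArg Subtype.val hq)
      have := FiniteDimensional.of_injective F hF
      exact Polynomial.not_finite this
    refine (q.rootSet_finite ℂ).subset fun x hx => ?_
    have h1 := spectrum.subset_polynomial_aeval a q ⟨x, hx, rfl⟩
    have := 𝔄.nontrivial
    have hnt : Nontrivial 𝔄.Obs :=
      ⟨0, 1, fun h => zero_ne_one (α := H →L[ℂ] H) (congrArg Subtype.val h)⟩
    rw [hq, spectrum.zero_eq] at h1
    rw [Polynomial.mem_rootSet]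
    exact ⟨hq0, by simpa using h1⟩
  obtain ⟨x, hx, y, hy, hxy⟩ : ∃ x ∈ spectrum ℂ a, ∃ y ∈ spectrum ℂ a, x ≠ y := by
    by_contra! hcon
    have hnt : (spectrum ℂ a).Nonempty := by
      have := 𝔄.nontrivial
      have hnt : Nontrivial 𝔄.Obs :=
        ⟨0, 1, fun h => zero_ne_one (α := H →L[ℂ] H) (congrArg Subtype.val h)⟩
      exact spectrum.nonempty a
    obtain ⟨x, hx⟩ := hnt
    refine hns x ?_
    rw [← Algebra.algebraMap_eq_smul_one, ← cfc_const x a]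
    conv_lhs => rw [← cfc_id' ℂ a]
    exact cfc_congr fun z hz => hcon z hz x hx
  have hcont (f : ℂ → ℂ) : ContinuousOn f (spectrum ℂ a) := hfin.continuousOn f
  classical
  -- The indicator of `x` is continuous on the finite spectrum. It gives the spectral projection at
  -- `x`, which is nonzero because of `x` and different from `1` because of `y`.
  set f : ℂ → ℂ := fun z => if z = x then 1 else 0 with hf
  refine ⟨cfc f a, fun b => ?_, ⟨?_, ?_⟩, fun h => ?_, fun h => ?_⟩
  · have h1 : Commute a (ρ b) := ha b
    have h2 : Commute (star a) (ρ b) := by rwa [hsa.star_eq]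
    exact Commute.cfc h1 h2 f
  · change cfc f a * cfc f a = cfc f a
    rw [← cfc_mul f f a (hcont f) (hcont f)]
    exact cfc_congr fun z _ => by simp only [hf]; split_ifs <;> simp
  · change star (cfc f a) = cfc f a
    rw [← cfc_star]
    exact cfc_congr fun z _ => by simp only [hf]; split_ifs <;> simp
  · rw [← cfc_zero ℂ a, cfc_eq_cfc_iff_eqOn hN (hcont _) (hcont _)] at h
    simpa [hf] using h hx
  · rw [← cfc_one ℂ a, cfc_eq_cfc_iff_eqOn hN (hcont _) (hcont _)] at h
    simpa [hf, hxy.symm] using h hy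

/-- The operators `s s*` with isometric intertwiners `s` from irreducible endomorphisms
into `ρ`. -/
def irreducibleProjections (ρ : DHREndo 𝔄) : Set 𝔄.Obs :=
  {e | ∃ σ : DHREndo 𝔄, IsIrreducibleEndo σ.toHom ∧
    ∃ s ∈ Intertwiners σ.toHom ρ.toHom, star s * s = 1 ∧ e = s * star s}

/-- Complete reducibility. -/
theorem one_mem_span_irreducibleProjections (ρ : DHREndo 𝔄)
    [hfd : FiniteDimensional ℂ (intertwinerSubmodule ρ.toHom ρ.toHom)] :
    (1 : 𝔄.Obs) ∈ Submodule.span ℂ (irreducibleProjections ρ) := by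
  induction hn : Module.finrank ℂ (intertwinerSubmodule ρ.toHom ρ.toHom) using
    Nat.strong_induction_on generalizing ρ with
  | _ n ih =>
  by_cases hirr : IsIrreducibleEndo ρ.toHom
  · exact Submodule.subset_span ⟨ρ, hirr, 1, fun a => by simp, by simp, by simp⟩
  obtain ⟨e, he, hp, h0, h1⟩ := exists_projection hirr
  have key (e : 𝔄.Obs) (he : e ∈ Intertwiners ρ.toHom ρ.toHom) (hp : IsStarProjection e)
      (h0 : e ≠ 0) (h1 : e ≠ 1) : e ∈ Submodule.span ℂ (irreducibleProjections ρ) := by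
    obtain ⟨σ, s, hs, hss, hse⟩ := ρ.exists_sub hp h0 he
    let F : 𝔄.Obs →ₗ[ℂ] 𝔄.Obs := (LinearMap.mulLeft ℂ s).comp (LinearMap.mulRight ℂ (star s))
    have hF (t : 𝔄.Obs) : F t = s * (t * star s) := rfl
    have hFmem (t : intertwinerSubmodule σ.toHom σ.toHom) :
        F t ∈ intertwinerSubmodule ρ.toHom ρ.toHom :=
      Intertwiners.mul_mem hs (Intertwiners.mul_mem t.2 (Intertwiners.star_mem hs))
    let G : intertwinerSubmodule σ.toHom σ.toHom →ₗ[ℂ] intertwinerSubmodule ρ.toHom ρ.toHom :=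
      (F.comp (Submodule.subtype _)).codRestrict _ hFmem
    have hG : Function.Injective G := by
      intro t t' h
      have h2 : F t = F t' := congrArg Subtype.val h
      have h3 (t : 𝔄.Obs) : star s * F t * s = t := by
        rw [hF, mul_assoc, mul_assoc, mul_assoc, hss, mul_one, ← mul_assoc, hss, one_mul]
      exact Subtype.ext (by rw [← h3 t, h2, h3])
    have hfdσ : FiniteDimensional ℂ (intertwinerSubmodule σ.toHom σ.toHom) :=
      FiniteDimensional.of_injective G hG
    have hlt : Module.finrank ℂ (intertwinerSubmodule σ.toHom σ.toHom) < n := by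
      rw [← LinearMap.finrank_range_of_inj hG, ← hn]
      -- Everything in the range of `G` is fixed by left multiplication with `e`; if `1` were in it,
      -- then `e = 1`.
      refine Submodule.finrank_lt fun htop => h1 ?_
      obtain ⟨t, ht⟩ : (⟨1, fun a => by simp⟩ : intertwinerSubmodule ρ.toHom ρ.toHom) ∈
          LinearMap.range G := htop ▸ Submodule.mem_top
      have h2 : F t = 1 := congrArg Subtype.val ht
      have h3 : e * F t = F t := by
        rw [← hse, hF, mul_assoc, ← mul_assoc (star s), hss, one_mul]
      rwa [h2, mul_one] at h3
    -- `F` carries the decomposition of `1` for the subobject `σ` to one of `e = s s*` for `ρ`.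
    have h2 := Submodule.mem_map_of_mem (f := F) (ih _ hlt σ rfl)
    rw [hF, one_mul, hse] at h2
    refine (Submodule.map_span_le F _ _).2 ?_ h2
    rintro _ ⟨τ, hτ, z, hz, hzz, rfl⟩
    refine Submodule.subset_span ⟨τ, hτ, s * z, Intertwiners.mul_mem hs hz, ?_, ?_⟩
    · rw [star_mul, mul_assoc, ← mul_assoc (star s), hss, one_mul, hzz]
    · rw [hF, star_mul]; simp only [mul_assoc]
  have h2 : 1 - e ∈ Intertwiners ρ.toHom ρ.toHom := fun a => by
    rw [sub_mul, mul_sub, he a, one_mul, mul_one]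
  rw [← add_sub_cancel e 1]
  exact Submodule.add_mem _ (key e he hp h0 h1)
    (key (1 - e) h2 hp.one_sub (sub_ne_zero.2 h1.symm) fun h => h0 (by simpa using h))

end Net

/-! ## Relative commutant and centre of braided products of Q-systems -/

section Net

variable {S : Spacetime}
  {H : Type*} [NormedAddCommGroup H] [InnerProductSpace ℂ H] [CompleteSpace H]

open LocalNet

variable {𝔄 : LocalNet H S}

/-- Intertwiners into a DHR endomorphism whose commutant is finite dimensional factor through
irreducible subobjects. -/
theorem mem_span_mul_star {ρ σ : DHREndo 𝔄}
    [FiniteDimensional ℂ (intertwinerSubmodule ρ.toHom ρ.toHom)] {t : 𝔄.Obs}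
    (ht : t ∈ Intertwiners σ.toHom ρ.toHom) :
    t ∈ Submodule.span ℂ {b : 𝔄.Obs | ∃ τ : DHREndo 𝔄, IsIrreducibleEndo τ.toHom ∧
      IsSubEndo τ.toHom ρ.toHom ∧ IsSubEndo τ.toHom σ.toHom ∧
      ∃ t₁ ∈ Intertwiners τ.toHom ρ.toHom, ∃ t₂ ∈ Intertwiners τ.toHom σ.toHom,
        b = t₁ * star t₂} := by
  -- Right multiplication by `t` turns a decomposition of `1` into terms `z z*` into terms `z (t*
  -- z)*`.
  have h := Submodule.mem_map_of_mem (f := LinearMap.mulRight ℂ t)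
    (one_mem_span_irreducibleProjections ρ)
  rw [LinearMap.mulRight_apply, one_mul] at h
  refine (Submodule.map_span_le _ _ _).2 ?_ h
  rintro _ ⟨τ, hτ, z, hz, hzz, rfl⟩
  rw [LinearMap.mulRight_apply]
  have hy : star t * z ∈ Intertwiners τ.toHom σ.toHom :=
    Intertwiners.mul_mem (Intertwiners.star_mem ht) hz
  have hzt : z * star z * t = z * star (star t * z) := by
    rw [star_mul, star_star, mul_assoc]
  set y := star t * z with hydef
  rw [hzt]
  by_cases hy0 : y = 0
  · rw [hy0, star_zero, mul_zero]
    exact Submodule.zero_mem _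
  refine Submodule.subset_span ⟨τ, hτ, ⟨z, hz, hzz⟩, ?_, z, hz, y, hy, rfl⟩
  -- By irreducibility of `τ`, `y* y` is a scalar, positive since `y ≠ 0`. Rescaling `y` gives the
  -- isometry required for `τ ≺ σ`.
  obtain ⟨c, hc⟩ := hτ _ (Intertwiners.mul_mem (Intertwiners.star_mem hy) hy)
  have := 𝔄.nontrivial
  obtain ⟨ξ, hξ⟩ := exists_norm_eq H zero_le_one
  have h1 := star_mul_eq_inner hξ (V := y) (W := y) fun a => by
    rw [hc, smul_mul_assoc, mul_smul_comm, one_mul, mul_one]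
  rw [inner_self_eq_norm_sq_to_K] at h1
  set d : ℝ := ‖(y : H →L[ℂ] H) ξ‖ with hd
  have hd0 : (d : ℂ) ≠ 0 := by
    intro h
    refine hy0 ((CStarRing.star_mul_self_eq_zero_iff _).1 (h1.trans ?_))
    change ((d : ℂ)) ^ 2 • _ = _
    rw [h, sq, zero_mul, zero_smul]
  refine ⟨(d : ℂ)⁻¹ • y, (intertwinerSubmodule τ.toHom σ.toHom).smul_mem _ hy, ?_⟩
  rw [star_smul, smul_mul_smul_comm, h1, smul_smul]
  change (star (d : ℂ)⁻¹ * (d : ℂ)⁻¹ * (d : ℂ) ^ 2) • (1 : 𝔄.Obs) = 1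
  rw [star_inv₀, show star (d : ℂ) = d from Complex.conj_ofReal d]
  field_simp
  exact one_smul _ _

namespace QSystem

variable (s : BraidSign) (A A₁ A₂ : QSystem 𝔄)

theorem toTriple_isFrobenius : A.toTriple.IsFrobenius := A.isFrobenius

theorem isUnitBraiding :
    A₁.toTriple.IsUnitBraiding A₂.toTriple (signedBraiding s A₁.θ A₂.θ) where
  mem := signedBraiding_mem s A₁.θ A₂.θ
  star_mul_self := (Unitary.mem_iff.1 (signedBraiding_mem_unitary s A₁.θ A₂.θ)).1
  mul_star_self := (Unitary.mem_iff.1 (signedBraiding_mem_unitary s A₁.θ A₂.θ)).2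
  mul_w₁ := signedBraiding_mul s A₁.θ A₂.θ A₁.isFrobenius.w_mem
  mul_map_w₂ := signedBraiding_mul_map s A₁.θ A₂.θ A₂.isFrobenius.w_mem

theorem braidedProduct_isUnital : (braidedProduct s A₁ A₂).IsUnital :=
  (isUnitBraiding s A₁ A₂).braided_isUnital A₁.toTriple_isFrobenius A₂.toTriple_isFrobenius

theorem star_ψ₁_mul_ψ₂ (t₁ t₂ : 𝔄.Obs) :
    star (ψ₁ s A₁ A₂ t₁) * ψ₂ s A₁ A₂ t₂ =
      Extension.mk _ (star A₁.w * star A₁.x * A₁.θ.toHom (t₁ * star t₂)) :=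
  (isUnitBraiding s A₁ A₂).star_field_mul_field A₁.toTriple_isFrobenius A₂.toTriple_isFrobenius
    t₁ t₂

theorem mem_intertwiners_braidedProduct_iff {a : 𝔄.Obs} :
    a ∈ Intertwiners (braidedProduct s A₁ A₂).θ (StarAlgHom.id ℂ 𝔄.Obs) ↔
      ∃ t ∈ Intertwiners A₂.θ.toHom A₁.θ.toHom, a = star A₁.w * star A₁.x * A₁.θ.toHom t :=
  A₁.toTriple_isFrobenius.mem_intertwiners_comp_iff

/-- The operator `x w` exhibits `θ` as its own conjugate. -/
instance finiteDimensional_commutant :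
    FiniteDimensional ℂ (intertwinerSubmodule A.θ.toHom A.θ.toHom) :=
  finiteDimensional_intertwiners A.toTriple_isFrobenius.x_mul_w_mem
    A.toTriple_isFrobenius.star_x_mul_w_mul_map

theorem relativeCommutant_eq_span :
    Extension.relativeCommutant (braidedProduct s A₁ A₂) =
      (Submodule.span ℂ (neutralProducts s A₁ A₂) : Set (ProductExtension s A₁ A₂)) := by
  have hU := braidedProduct_isUnital s A₁ A₂
  apply Set.Subset.antisymm
  · intro b hb
    obtain ⟨a, rfl⟩ := (Extension.mk (braidedProduct s A₁ A₂)).surjective b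
    rw [Extension.mk_mem_relativeCommutant hU, mem_intertwiners_braidedProduct_iff] at hb
    obtain ⟨t, ht, rfl⟩ := hb
    -- `F` is the Frobenius reciprocity map `t ↦ ι(w₁* x₁* θ₁(t))v`; being linear, it carries the
    -- span of the `t₁ t₂*` into that of the field products.
    let F : 𝔄.Obs →ₗ[ℂ] ProductExtension s A₁ A₂ :=
      (Extension.mk (braidedProduct s A₁ A₂)).toLinearMap.comp
        ((LinearMap.mulLeft ℂ (star A₁.w * star A₁.x)).comp A₁.θ.toHom.toAlgHom.toLinearMap)
    refine (Submodule.map_span_le F _ _).2 ?_ (Submodule.mem_map_of_mem (mem_span_mul_star ht))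
    rintro _ ⟨τ, hτ, h₁, h₂, t₁, ht₁, t₂, ht₂, rfl⟩
    exact Submodule.subset_span ⟨τ, hτ, h₁, h₂, t₁, ht₁, t₂, ht₂,
      (star_ψ₁_mul_ψ₂ s A₁ A₂ t₁ t₂).symm⟩
  · change _ ≤ Extension.relativeCommutantSubmodule hU
    rw [Submodule.span_le]
    rintro _ ⟨τ, -, -, -, t₁, ht₁, t₂, ht₂, rfl⟩
    change _ ∈ Extension.relativeCommutant (braidedProduct s A₁ A₂)
    rw [star_ψ₁_mul_ψ₂, Extension.mk_mem_relativeCommutant hU,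
      mem_intertwiners_braidedProduct_iff]
    exact ⟨_, Intertwiners.mul_mem ht₁ (Intertwiners.star_mem ht₂), rfl⟩

variable {A A₁ A₂}

theorem IsCommutative.signedBraiding_mul_x (h : A.IsCommutative) :
    signedBraiding s A.θ A.θ * A.x = A.x := by
  cases s
  · exact h
  · have hu : star (A.θ.braiding A.θ) * A.θ.braiding A.θ = 1 :=
      (Unitary.mem_iff.1 (signedBraiding_mem_unitary .plus A.θ A.θ)).1
    change star (A.θ.braiding A.θ) * A.x = A.x
    conv_lhs => rw [← show A.θ.braiding A.θ * A.x = A.x from h]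
    rw [← mul_assoc, hu, one_mul]

/-- Extensions by commutative Q-systems are local. -/
theorem IsCommutative.isLocalExtension (h : A.IsCommutative) : A.IsLocalExtension := by
  rintro O P hOP _ ⟨a, u, ha, hu, rfl⟩ _ ⟨b, v, hb, hv, rfl⟩
  have hU := A.toTriple_isFrobenius.isUnital
  simp only [Extension.v, Extension.ι_mul_mk hU, mul_one, Extension.mk_mul_mk]
  congr 1
  -- The order of `O` and `P` decides whether the exchange operator is `ε⁺` or `ε⁻`; commutativity
  -- makes both fix `x`.
  have hex : exchange A.θ.toHom A.θ.toHom u v * A.x = A.x := by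
    rcases hOP with hOP | hOP
    · rw [← signedBraiding_eq (s := .minus) hu hv hOP]
      exact h.signedBraiding_mul_x _
    · rw [← signedBraiding_eq (s := .plus) hu hv hOP]
      exact h.signedBraiding_mul_x _
  have hx : u * A.θ.toHom v * A.x = v * A.θ.toHom u * A.x := by
    calc u * A.θ.toHom v * A.x
        = (v * (A.θ.toHom (u * star u)) * star v) * u * A.θ.toHom v * A.x := by
          rw [hu.mul_star_self, map_one, mul_one, hv.mul_star_self, one_mul]
      _ = v * A.θ.toHom u * (exchange A.θ.toHom A.θ.toHom u v * A.x) := by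
          simp only [exchange, map_mul, mul_assoc]
      _ = v * A.θ.toHom u * A.x := by rw [hex]
  calc a * u * A.θ.toHom (b * v) * A.x
      = a * (u * A.θ.toHom b) * A.θ.toHom v * A.x := by simp only [map_mul, mul_assoc]
    _ = a * b * (u * A.θ.toHom v * A.x) := by
        rw [hu.mul_map hOP.symm hb]; simp only [mul_assoc]
    _ = b * (a * v) * A.θ.toHom u * A.x := by
        rw [hx, ha.commute hb hOP]; simp only [mul_assoc]
    _ = b * v * A.θ.toHom (a * u) * A.x := by
        rw [← hv.mul_map hOP ha]; simp only [map_mul, mul_assoc]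

theorem relativeCommutant_eq_centre (h₁ : A₁.IsCommutative) (h₂ : A₂.IsCommutative) :
    Extension.relativeCommutant (braidedProduct s A₁ A₂) =
      Extension.centre (braidedProduct s A₁ A₂) := by
  refine Set.Subset.antisymm ?_ (Extension.centre_subset_relativeCommutant _)
  intro b hb
  obtain ⟨a, rfl⟩ := (Extension.mk (braidedProduct s A₁ A₂)).surjective b
  rw [Extension.mk_mem_relativeCommutant (braidedProduct_isUnital s A₁ A₂)] at hb
  have hun := signedBraiding_mem_unitary s.opp A₁.θ A₁.θ
  -- The opposite sign is needed here: it makes the braiding of `θ₂` with `θ₁` the adjoint of the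
  -- `ε^s_{θ₁,θ₂}` occurring in the product. Past `θ₂` the sign `s` itself produces that braiding.
  have k₁ := map_mul_signedBraiding_mul s.opp A₁.θ A₂.θ A₁.θ hb
  rw [← star_signedBraiding s A₁.θ A₂.θ] at k₁
  exact Extension.mk_mem_centre hb
    (A₁.toTriple_isFrobenius.mul_braided_x (T₂ := A₂.toTriple)
      (isUnitBraiding s A₁ A₂).star_mul_self k₁
      (map_mul_signedBraiding_mul s A₁.θ A₂.θ A₂.θ hb)
      (Unitary.mem_iff.1 hun).1 (Unitary.mem_iff.1 hun).2
      (h₁.signedBraiding_mul_x _) (h₂.signedBraiding_mul_x _))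

end QSystem

end Net

theorem proposition4p15 {S : Spacetime}
    {H : Type*} [NormedAddCommGroup H] [InnerProductSpace ℂ H] [CompleteSpace H]
    (𝔄 : LocalNet H S) (A₁ A₂ : QSystem 𝔄) :
    (∀ s : BraidSign,
      Extension.relativeCommutant (QSystem.braidedProduct s A₁ A₂) =
        (Submodule.span ℂ (QSystem.neutralProducts s A₁ A₂) :
          Set (QSystem.ProductExtension s A₁ A₂))) ∧
    (A₁.IsCommutative → A₂.IsCommutative →
      A₁.IsLocalExtension ∧ A₂.IsLocalExtension ∧
      ∀ s : BraidSign,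
        Extension.relativeCommutant (QSystem.braidedProduct s A₁ A₂) =
          Extension.centre (QSystem.braidedProduct s A₁ A₂)) :=
  ⟨fun s => QSystem.relativeCommutant_eq_span s A₁ A₂, fun h₁ h₂ =>
    ⟨h₁.isLocalExtension, h₂.isLocalExtension, fun s =>
      QSystem.relativeCommutant_eq_centre s h₁ h₂⟩⟩
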